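/- Let $\lambda:\mathbb{Z}_+\to[0,\infty)$ be an arbitrary function and let $\mu_1,\mu_2>0$. The system $S(\lambda,\mu_1,\mu_2)$ is the set of transition rates on $\mathbb{Z}_+^2$ given, for $x\ne y$, by $q(x,x+e_1)=\lambda(x_2)$, $q(x,x-e_1+e_2)=\mu_1$ if $x_1\ge 1$, $q(x,x-e_2)=\mu_2$ if $x_2\ge 1$, and $q(x,y)=0$ otherwise. It is called stable if the minimal continuous-time Markov process $X$ with these rates (sent to an extra state $\kappa$ at its explosion time) is ergodic, i.e. irreducible (every state is reached with positive probability from every state) and positive recurrent (the time $T_x=\inf\{t>0: X(t-)\ne X(t),\,X(t)=x\}$ has finite mean when $X(0)=x$, for every non-absorbing state $x$). For $V:\mathbb{Z}_+^2\to\mathbb{R}$ write $\Delta V(x)=\sum_{y\neq x}(V(y)-V(x))\,q(x,y)$. Call $V$ a (Foster–)Lyapunov function for $q$ if (F1) $\sum_{y\ne x}|V(y)-V(x)|\,q(x,y)<\infty$ for all $x$; (F2) $\{x:V(x)\le M\}$ is finite for every $M\in\mathbb{R}$; (F3) there is a finite set $S_0\subset\mathbb{Z}_+^2$ with $\sup_{x\notin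 S_0}\Delta V(x)<0$. For $r>0$ put $$V_r(x)=x_1+\sum_{j=0}^{x_2-1}\sum_{k=0}^{j}\Bigl(1-\frac{\lambda(k)+r}{\mu_1}\Bigr)\Bigl(\frac{\mu_1}{\mu_2}\Bigr)^{k-j}.$$ For $n\ge 0$ let $Z_n$ be a truncated geometric random variable with law $\mathrm{geom}_n(\mu_1/\mu_2)$: $P(Z_n=j)=c_n(\mu_1/\mu_2)^j$ for $0\le j\le n$, with $c_n$ the normalizing constant. **Theorem.** (0) For every $r>0$, $V_r$ is the unique function of the form $V(x)=x_1+v(x_2)$ with $v(0)=0$ such that $\Delta V(x)=-r$ for all $x$ with $x_1>0$. (1) The family $\{V_r:r>0\}$ contains a Lyapunov function for $S(\lambda,\mu_1,\mu_2)$ if and only if $$\limsup_{n\to\infty}\mathbb{E}\,\lambda(Z_n)<\min(\mu_1,\mu_2),\tag{$*$}$$ where the upper limit is taken in $[0,\infty]$. (2) In particular, if $\lambda(0)>0$, then $(*)$ is sufficient for the stability of $S(\lambda,\mu_1,\mu_2)$. -/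

import Mathlib

open MeasureTheory ProbabilityTheory Filter Topology
open scoped ENNReal NNReal

noncomputable section

/-! Markov jump processes on a countable set, given by transition rates `q x y`, `x ≠ y`.
Diagonal values `q x x` are never used. -/

section JumpProcess

variable {S : Type*}

open Classical in
/-- The transition rate `q(x, y)` for `y ≠ x`, as an extended nonnegative real; `0` for `y = x`. -/
def offDiagRate (q : S → S → ℝ) (x y : S) : ℝ≥0∞ :=
  if y = x then 0 else ENNReal.ofReal (q x y)

/-- The transition rate out of `x`, that is `q(x) = ∑_{y ≠ x} q(x, y)`. -/
def exitRate (q : S → S → ℝ) (x : S) : ℝ≥0∞ := ∑' y, offDiagRate q x y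

variable [MeasurableSpace S]

open Classical in
/-- Law of the state entered at the next jump from `x`: it is `y ≠ x` with probability
`q(x, y) / q(x)`. If `q(x) = 0` the state `x` is absorbing. (Rates with `q(x) = ∞` are not
considered; the value there is a convention.) -/
def jumpLaw (q : S → S → ℝ) (x : S) : Measure S :=
  if h : exitRate q x ≠ 0 ∧ exitRate q x ≠ ∞ then
    (PMF.normalize (offDiagRate q x) h.1 h.2).toMeasure
  else Measure.dirac x

open Classical in
/-- Law of the time spent in `x` before the next jump: exponential with rate `q(x)`, and
infinite if `q(x) = 0`. -/
def holdingLaw (q : S → S → ℝ) (x : S) : Measure ℝ≥0∞ :=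
  if exitRate q x ≠ 0 ∧ exitRate q x ≠ ∞ then
    (expMeasure (exitRate q x).toReal).map ENNReal.ofReal
  else Measure.dirac ∞

instance jumpLaw_isProbabilityMeasure (q : S → S → ℝ) (x : S) :
    IsProbabilityMeasure (jumpLaw q x) := by
  unfold jumpLaw
  split_ifs <;> infer_instance

instance holdingLaw_isProbabilityMeasure (q : S → S → ℝ) (x : S) :
    IsProbabilityMeasure (holdingLaw q x) := by
  unfold holdingLaw
  split_ifs with h
  · have := isProbabilityMeasure_expMeasure (ENNReal.toReal_pos h.1 h.2)
    exact Measure.isProbabilityMeasure_map ENNReal.measurable_ofReal.aemeasurable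
  · infer_instance

/-- Joint law of a deterministic state `x` and the time spent there. -/
def stateHoldingLaw (q : S → S → ℝ) (x : S) : Measure (S × ℝ≥0∞) :=
  (Measure.dirac x).prod (holdingLaw q x)

instance stateHoldingLaw_isProbabilityMeasure (q : S → S → ℝ) (x : S) :
    IsProbabilityMeasure (stateHoldingLaw q x) := by
  unfold stateHoldingLaw
  infer_instance

variable [Countable S] [MeasurableSingletonClass S]

/-- `x ↦ jumpLaw q x` as a kernel. -/
def jumpKernel (q : S → S → ℝ) : Kernel S S := Kernel.ofFunOfCountable (jumpLaw q)

instance jumpKernel_isMarkovKernel (q : S → S → ℝ) : IsMarkovKernel (jumpKernel q) :=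
  ⟨fun x => jumpLaw_isProbabilityMeasure q x⟩

/-- `x ↦ stateHoldingLaw q x` as a kernel. -/
def stateHoldingKernel (q : S → S → ℝ) : Kernel S (S × ℝ≥0∞) :=
  Kernel.ofFunOfCountable (stateHoldingLaw q)

instance stateHoldingKernel_isMarkovKernel (q : S → S → ℝ) :
    IsMarkovKernel (stateHoldingKernel q) :=
  ⟨fun x => stateHoldingLaw_isProbabilityMeasure q x⟩

/-- One step of the chain of pairs (visited state, time spent there): from `(x, h)`, first choose
the next state `y` by `jumpLaw q x`, then its holding time by `holdingLaw q y`. -/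
def stepKernel (q : S → S → ℝ) : Kernel (S × ℝ≥0∞) (S × ℝ≥0∞) :=
  (stateHoldingKernel q ∘ₖ jumpKernel q).comap Prod.fst measurable_fst

instance stepKernel_isMarkovKernel (q : S → S → ℝ) : IsMarkovKernel (stepKernel q) := by
  unfold stepKernel
  infer_instance

/-- `stepKernel`, seen as a kernel that depends on the whole past through the last pair. -/
def historyKernel (q : S → S → ℝ) (n : ℕ) :
    Kernel ((_ : Finset.Iic n) → S × ℝ≥0∞) (S × ℝ≥0∞) :=
  (stepKernel q).comap (fun ω => ω ⟨n, Finset.mem_Iic.2 le_rfl⟩) (measurable_pi_apply _)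

instance historyKernel_isMarkovKernel (q : S → S → ℝ) (n : ℕ) :
    IsMarkovKernel (historyKernel q n) := by
  unfold historyKernel
  infer_instance

/-- The law `P_x` of the sequence (visited state, time spent there) of the Markov process with
rates `q` started at `x`. -/
def processLaw (q : S → S → ℝ) (x : S) : Measure (ℕ → S × ℝ≥0∞) :=
  Kernel.trajMeasure (X := fun _ => S × ℝ≥0∞) (stateHoldingLaw q x) (historyKernel q)

end JumpProcess

section Paths

variable {S : Type*}

/-- The time of the `n`-th jump (`0` for `n = 0`). -/
def jumpTime (ω : ℕ → S × ℝ≥0∞) (n : ℕ) : ℝ≥0∞ := ∑ k ∈ Finset.range n, (ω k).2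

open Classical in
/-- The state `X(t)` at time `t` of the minimal process: the `n`-th visited state if `t` lies
between the `n`-th and the `(n+1)`-th jump time, and the additional state `κ = none` if `t` is not
smaller than the explosion time. -/
def statePath (ω : ℕ → S × ℝ≥0∞) (t : ℝ≥0) : Option S :=
  if h : ∃ n, jumpTime ω n ≤ t ∧ (t : ℝ≥0∞) < jumpTime ω (n + 1) then
    some (ω (Nat.find h)).1
  else none

/-- `T_x = inf {t > 0 : X(t-) ≠ X(t), X(t) = x}`, the first time at which `X` jumps into `x`. -/
def returnTime (x : S) (ω : ℕ → S × ℝ≥0∞) : ℝ≥0∞ :=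
  ⨅ (t : ℝ≥0) (_ : 0 < t ∧ (¬ ∀ᶠ s in 𝓝[<] t, statePath ω s = statePath ω t) ∧
    statePath ω t = some x), (t : ℝ≥0∞)

variable [MeasurableSpace S] [Countable S] [MeasurableSingletonClass S]

/-- Every state is reached with positive probability from every state. -/
def IsIrreducibleProcess (q : S → S → ℝ) : Prop :=
  ∀ x y, 0 < processLaw q x {ω | ∃ t, statePath ω t = some y}

/-- Every state is absorbing or has a finite mean return time. -/
def IsPositiveRecurrentProcess (q : S → S → ℝ) : Prop :=
  ∀ x, exitRate q x = 0 ∨ ∫⁻ ω, returnTime x ω ∂(processLaw q x) < ∞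

/-- The minimal Markov process with rates `q` is irreducible and positive recurrent. -/
def IsErgodicProcess (q : S → S → ℝ) : Prop :=
  IsIrreducibleProcess q ∧ IsPositiveRecurrentProcess q

end Paths

section Lyapunov

variable {S : Type*}

/-- The mean drift `ΔV(x) = ∑_{y ≠ x} (V(y) - V(x)) q(x, y)`. -/
def meanDrift (q : S → S → ℝ) (V : S → ℝ) (x : S) : ℝ :=
  ∑' y : {y : S // y ≠ x}, (V y - V x) * q x y

/-- `V` is a (Foster-)Lyapunov function for `q`. The supremum is taken in the extended reals. -/
structure IsLyapunovFunction (q : S → S → ℝ) (V : S → ℝ) : Prop where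
  summable : ∀ x, Summable fun y : {y : S // y ≠ x} => |V y - V x| * q x y
  tendsto : ∀ M : ℝ, {x | V x ≤ M}.Finite
  drift : ∃ S₀ : Finset S, (⨆ x ∈ {x : S | x ∉ S₀}, (meanDrift q V x : EReal)) < 0

end Lyapunov

section Tandem

/-- The transition rates of the system `S(lam, μ₁, μ₂)` on `ℤ₊²`: arrivals to node 1 at rate
`lam x₂`, transfers from node 1 to node 2 at rate `μ₁`, departures from node 2 at rate `μ₂`. -/
def tandemRate (lam : ℕ → ℝ) (μ₁ μ₂ : ℝ) (x y : ℕ × ℕ) : ℝ :=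
  if y.1 = x.1 + 1 ∧ y.2 = x.2 then lam x.2
  else if y.1 + 1 = x.1 ∧ y.2 = x.2 + 1 then μ₁
  else if y.1 = x.1 ∧ y.2 + 1 = x.2 then μ₂
  else 0

/-- The system is stable if the corresponding minimal Markov process is ergodic. -/
def IsStableTandem (lam : ℕ → ℝ) (μ₁ μ₂ : ℝ) : Prop :=
  IsErgodicProcess (tandemRate lam μ₁ μ₂)

/-- `v_r(n) = ∑_{j=0}^{n-1} ∑_{k=0}^{j} (1 - (lam k + r) / μ₁) (μ₁ / μ₂)^{k-j}`. -/
def tandemV (lam : ℕ → ℝ) (μ₁ μ₂ r : ℝ) (n : ℕ) : ℝ :=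
  ∑ j ∈ Finset.range n, ∑ k ∈ Finset.range (j + 1),
    (1 - (lam k + r) / μ₁) * (μ₁ / μ₂) ^ ((k : ℤ) - (j : ℤ))

/-- `V_r(x) = x₁ + v_r(x₂)`. -/
def tandemLyapunov (lam : ℕ → ℝ) (μ₁ μ₂ r : ℝ) (x : ℕ × ℕ) : ℝ :=
  (x.1 : ℝ) + tandemV lam μ₁ μ₂ r x.2

/-- The family `{V_r : r > 0}`. -/
def tandemFamily (lam : ℕ → ℝ) (μ₁ μ₂ : ℝ) : Set (ℕ × ℕ → ℝ) :=
  {V | ∃ r : ℝ, 0 < r ∧ V = tandemLyapunov lam μ₁ μ₂ r}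

/-- The law `geom_n(z)` on `{0, …, n}`: mass `z^j / ∑_{i=0}^n z^i` at `j`. -/
def truncGeom (n : ℕ) (z : ℝ) : Measure ℕ :=
  ∑ j ∈ Finset.range (n + 1),
    ENNReal.ofReal (z ^ j / ∑ i ∈ Finset.range (n + 1), z ^ i) • Measure.dirac j

/-- `limsup_n E lam(Z_n) < min(μ₁, μ₂)`, where `Z_n` has law `geom_n(μ₁ / μ₂)`. The upper limit
is taken in the extended reals, since the means need not be bounded. -/
def LimsupCondition (lam : ℕ → ℝ) (μ₁ μ₂ : ℝ) : Prop :=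
  limsup (fun n => ((∫ j, lam j ∂(truncGeom n (μ₁ / μ₂)) : ℝ) : EReal)) atTop
    < ((min μ₁ μ₂ : ℝ) : EReal)

end Tandem

end

/-! For `V = x₁ + v(x₂)`, the equation `ΔV = -r` on `x₁ > 0` is a first-order linear recurrence for
the increments of `v`; `v(0) = 0` then fixes `v`. Only the boundary `x₁ = 0` remains to be
controlled. There the recurrence reduces the drift at height `n ≥ 1` to `μ₁ - r - μ₁ (v(n+1) -
v(n))`, so (F3) asks for large increments.

By `tandemV_increment`, `μ₁ (v(n+1) - v(n)) = aₙ (μ₁ - E lam(Zₙ) - r)` with `aₙ = ∑_{k ≤ n}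
(μ₂/μ₁)^k`, and `1/aₙ` tends to `1 - min(μ₁, μ₂)/μ₁`. Dividing by `aₙ` turns a boundary drift
bounded away from `0` into a bound on the means strictly below `min(μ₁, μ₂)`. Conversely, a gap
below the minimum leaves room for an `r > 0` with all late increments at least `1`, which gives both
(F2) and (F3).

Stability follows from Foster's criterion `IsLyapunovFunction.ergodic`. For a target state `x`, a
function `f` built from discounted hitting probabilities of `x` corrects `V` on the finite
exceptional set, giving `W` with `1/q + f + PW ≤ W` off `x`, where `P` is the jump chain. The cost
`1/q` bounds the mean time spent before return; the cost `f`, with the finite sublevel sets of `W`,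
forces return and so excludes explosion before it. -/

noncomputable section

/-! ### Holding times, jump probabilities and the Markov property. -/

section ProcessLaw

variable {S : Type*}

lemma lintegral_normalize_toMeasure [MeasurableSpace S] [Countable S] [MeasurableSingletonClass S]
    (f : S → ℝ≥0∞) (h0 : tsum f ≠ 0) (h1 : tsum f ≠ ∞) (g : S → ℝ≥0∞) :
    ∫⁻ y, g y ∂(PMF.normalize f h0 h1).toMeasure = (tsum f)⁻¹ * ∑' y, f y * g y := by
  rw [lintegral_countable', ← ENNReal.tsum_mul_left]
  refine tsum_congr fun y => ?_
  rw [PMF.toMeasure_apply_singleton _ _ (measurableSet_singleton y), PMF.normalize_apply]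
  ring

lemma lintegral_ofReal_expMeasure {r : ℝ} (hr : 0 < r) :
    ∫⁻ x, ENNReal.ofReal x ∂(expMeasure r) = ENNReal.ofReal r⁻¹ := by
  -- Size-biasing an exponential density gives `r⁻¹` times a Gamma density of shape `2`, whose total
  -- mass is `1`.
  have h : ∀ x, exponentialPDF r x * ENNReal.ofReal x
      = ENNReal.ofReal r⁻¹ * gammaPDF 2 r x := by
    intro x
    rcases lt_or_ge x 0 with hx | hx
    · rw [exponentialPDF_of_neg hx, gammaPDF_of_neg hx]; simp
    · rw [exponentialPDF_of_nonneg hx, gammaPDF_of_nonneg hx, ← ENNReal.ofReal_mul (by positivity),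
        ← ENNReal.ofReal_mul (by positivity)]
      congr 1
      have : Real.Gamma 2 = 1 := Real.Gamma_two
      rw [this]
      have h2 : x ^ ((2 : ℝ) - 1) = x := by norm_num
      have h3 : r ^ (2 : ℝ) = r ^ 2 := by norm_cast
      rw [h2, h3]
      field_simp
  have hm : Measurable (exponentialPDF r) :=
    (measurable_exponentialPDFReal r).ennreal_ofReal
  change ∫⁻ x, ENNReal.ofReal x ∂(volume.withDensity (exponentialPDF r)) = _
  rw [lintegral_withDensity_eq_lintegral_mul _ hm ENNReal.measurable_ofReal]
  simp only [Pi.mul_apply, h]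
  have hm2 : Measurable (gammaPDF 2 r) := (measurable_gammaPDFReal 2 r).ennreal_ofReal
  rw [lintegral_const_mul _ hm2, lintegral_gammaPDF_eq_one two_pos hr, mul_one]

lemma lintegral_holdingLaw {q : S → S → ℝ} {x : S} (h0 : exitRate q x ≠ 0)
    (h1 : exitRate q x ≠ ∞) : ∫⁻ h, h ∂(holdingLaw q x) = (exitRate q x)⁻¹ := by
  have hpos := ENNReal.toReal_pos h0 h1
  rw [holdingLaw, if_pos ⟨h0, h1⟩, lintegral_map (f := fun h => h) measurable_id ENNReal.measurable_ofReal]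
  rw [lintegral_ofReal_expMeasure hpos, ENNReal.ofReal_inv_of_pos hpos, ENNReal.ofReal_toReal h1]

lemma ae_holdingLaw {q : S → S → ℝ} {x : S} (h0 : exitRate q x ≠ 0)
    (h1 : exitRate q x ≠ ∞) : ∀ᵐ h ∂(holdingLaw q x), h ≠ 0 ∧ h ≠ ∞ := by
  rw [holdingLaw, if_pos ⟨h0, h1⟩, ae_map_iff ENNReal.measurable_ofReal.aemeasurable]
  · have hpos := ENNReal.toReal_pos h0 h1
    rw [ae_iff]
    have : {a : ℝ | ¬(ENNReal.ofReal a ≠ 0 ∧ ENNReal.ofReal a ≠ ∞)} = Set.Iic 0 := by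
      ext a; simp
    rw [this]
    change volume.withDensity (exponentialPDF (exitRate q x).toReal) _ = 0
    rw [withDensity_apply _ measurableSet_Iic, setLIntegral_congr Iio_ae_eq_Iic.symm]
    exact lintegral_exponentialPDF_of_nonpos le_rfl
  · exact (measurableSet_singleton 0).compl.inter (measurableSet_singleton ∞).compl

variable [MeasurableSpace S]

lemma lintegral_jumpLaw [Countable S] [MeasurableSingletonClass S]
    {q : S → S → ℝ} {x : S} (h0 : exitRate q x ≠ 0)
    (h1 : exitRate q x ≠ ∞) (g : S → ℝ≥0∞) :
    ∫⁻ y, g y ∂(jumpLaw q x) = (exitRate q x)⁻¹ * ∑' y, offDiagRate q x y * g y := by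
  rw [jumpLaw, dif_pos ⟨h0, h1⟩]
  exact lintegral_normalize_toMeasure _ h0 h1 g

lemma jumpLaw_singleton [Countable S] [MeasurableSingletonClass S]
    {q : S → S → ℝ} {x : S} (h0 : exitRate q x ≠ 0)
    (h1 : exitRate q x ≠ ∞) (y : S) :
    jumpLaw q x {y} = offDiagRate q x y * (exitRate q x)⁻¹ := by
  rw [jumpLaw, dif_pos ⟨h0, h1⟩, PMF.toMeasure_apply_singleton _ _ (measurableSet_singleton y)]
  rfl

lemma lintegral_stateHoldingLaw [MeasurableSingletonClass S] (q : S → S → ℝ) (x : S) {g : S × ℝ≥0∞ → ℝ≥0∞}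
    (hg : Measurable g) :
    ∫⁻ p, g p ∂(stateHoldingLaw q x) = ∫⁻ h, g (x, h) ∂(holdingLaw q x) := by
  rw [stateHoldingLaw, lintegral_prod _ hg.aemeasurable, lintegral_dirac]

variable [Countable S] [MeasurableSingletonClass S]

lemma lintegral_stepKernel (q : S → S → ℝ) (p : S × ℝ≥0∞) {g : S × ℝ≥0∞ → ℝ≥0∞}
    (hg : Measurable g) :
    ∫⁻ s, g s ∂(stepKernel q p) = ∫⁻ y, ∫⁻ h, g (y, h) ∂(holdingLaw q y) ∂(jumpLaw q p.1) := by
  rw [stepKernel, Kernel.comap_apply, Kernel.lintegral_comp _ _ _ hg]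
  refine lintegral_congr fun y => ?_
  exact lintegral_stateHoldingLaw q y hg

instance processLaw_isProbabilityMeasure (q : S → S → ℝ) (x : S) :
    IsProbabilityMeasure (processLaw q x) := by
  unfold processLaw
  infer_instance

lemma processLaw_map_zero (q : S → S → ℝ) (x : S) :
    (processLaw q x).map (fun ω => ω 0) = stateHoldingLaw q x := by
  have h : (fun ω : ℕ → S × ℝ≥0∞ => ω 0)
      = (fun ω : (_ : Finset.Iic 0) → S × ℝ≥0∞ => ω ⟨0, Finset.mem_Iic.2 le_rfl⟩) ∘
        Preorder.frestrictLe (π := fun _ => S × ℝ≥0∞) 0 := rfl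
  rw [h, ← Measure.map_map (by fun_prop) (by fun_prop), processLaw, Kernel.trajMeasure,
    Measure.map_comp _ _ (by fun_prop), Kernel.traj_map_frestrictLe, Kernel.partialTraj_self,
    Measure.id_comp, Measure.map_map (by fun_prop) (by fun_prop)]
  exact Measure.map_id

/-- The Markov property: given the past up to time `n`, the law of the next pair is
`stepKernel`. -/
lemma lintegral_processLaw_succ (q : S → S → ℝ) (x : S) (n : ℕ)
    {F : ((_ : Finset.Iic n) → S × ℝ≥0∞) → ℝ≥0∞} (hF : Measurable F)
    {g : S × ℝ≥0∞ → ℝ≥0∞} (hg : Measurable g) :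
    ∫⁻ ω, F (Preorder.frestrictLe n ω) * g (ω (n + 1)) ∂(processLaw q x)
      = ∫⁻ ω, F (Preorder.frestrictLe n ω) *
        (∫⁻ y, ∫⁻ h, g (y, h) ∂(holdingLaw q y) ∂(jumpLaw q (ω n).1)) ∂(processLaw q x) := by
  have key := Kernel.map_frestrictLe_trajMeasure_compProd_eq_map_trajMeasure
    (X := fun _ => S × ℝ≥0∞) (κ := historyKernel q) (μ₀ := stateHoldingLaw q x) (a := n)
  have hG : Measurable fun p : ((_ : Finset.Iic n) → S × ℝ≥0∞) × (S × ℝ≥0∞) => F p.1 * g p.2 := by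
    fun_prop
  have h1 := congrArg (fun ν => ∫⁻ p, F p.1 * g p.2 ∂ν) key
  beta_reduce at h1
  rw [lintegral_map hG (by fun_prop), Measure.lintegral_compProd hG, lintegral_map _ (by fun_prop)]
    at h1
  · rw [processLaw, ← h1]
    refine lintegral_congr fun ω => ?_
    dsimp only
    rw [lintegral_const_mul _ hg, historyKernel, Kernel.comap_apply, lintegral_stepKernel q _ hg]
    rfl
  · exact hG.lintegral_kernel_prod_right'

end ProcessLaw

/-! ### Deterministic properties of trajectories. -/

section PathLemmas

variable {S : Type*} {ω : ℕ → S × ℝ≥0∞}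

lemma jumpTime_succ (ω : ℕ → S × ℝ≥0∞) (n : ℕ) :
    jumpTime ω (n + 1) = jumpTime ω n + (ω n).2 := Finset.sum_range_succ _ _

lemma monotone_jumpTime (ω : ℕ → S × ℝ≥0∞) : Monotone (jumpTime ω) :=
  monotone_nat_of_le_succ fun n => by rw [jumpTime_succ]; exact le_self_add

lemma jumpTime_ne_top (hω : ∀ k, (ω k).2 ≠ 0 ∧ (ω k).2 ≠ ∞) (n : ℕ) : jumpTime ω n ≠ ∞ :=
  ENNReal.sum_ne_top.2 fun k _ => (hω k).2

lemma jumpTime_lt_succ (hω : ∀ k, (ω k).2 ≠ 0 ∧ (ω k).2 ≠ ∞) (n : ℕ) :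
    jumpTime ω n < jumpTime ω (n + 1) := by
  rw [jumpTime_succ]
  exact ENNReal.lt_add_right (jumpTime_ne_top hω n) (hω n).1

lemma statePath_eq {n : ℕ} {t : ℝ≥0} (h1 : jumpTime ω n ≤ t)
    (h2 : (t : ℝ≥0∞) < jumpTime ω (n + 1)) : statePath ω t = some (ω n).1 := by
  classical
  have h : ∃ n, jumpTime ω n ≤ t ∧ (t : ℝ≥0∞) < jumpTime ω (n + 1) := ⟨n, h1, h2⟩
  have hs := Nat.find_spec h
  have hle := Nat.find_min' h ⟨h1, h2⟩
  have : Nat.find h = n := by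
    by_contra hne
    have : Nat.find h + 1 ≤ n := by omega
    exact absurd (hs.2.trans_le ((monotone_jumpTime ω this).trans h1)) (lt_irrefl _)
  rw [statePath, dif_pos h]
  congr 3

lemma exists_statePath_eq (hω : ∀ k, (ω k).2 ≠ 0 ∧ (ω k).2 ≠ ∞) (n : ℕ) :
    ∃ t, statePath ω t = some (ω n).1 := by
  lift jumpTime ω n to ℝ≥0 using jumpTime_ne_top hω n with t ht
  exact ⟨t, statePath_eq ht.ge (ht ▸ jumpTime_lt_succ hω n)⟩

lemma returnTime_le_jumpTime (hω : ∀ k, (ω k).2 ≠ 0 ∧ (ω k).2 ≠ ∞) {x : S} {n : ℕ}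
    (h1 : (ω n).1 ≠ x) (h2 : (ω (n + 1)).1 = x) : returnTime x ω ≤ jumpTime ω (n + 1) := by
  have hlt := jumpTime_lt_succ hω n
  obtain ⟨t, ht⟩ : ∃ t : ℝ≥0, (t : ℝ≥0∞) = jumpTime ω (n + 1) :=
    ⟨_, ENNReal.coe_toNNReal (jumpTime_ne_top hω (n + 1))⟩
  obtain ⟨s, hs⟩ : ∃ s : ℝ≥0, (s : ℝ≥0∞) = jumpTime ω n :=
    ⟨_, ENNReal.coe_toNNReal (jumpTime_ne_top hω n)⟩
  have hst : s < t := by rw [← hs, ← ht] at hlt; exact_mod_cast hlt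
  have ht0 : 0 < t := pos_of_gt hst
  have hx : statePath ω t = some x := by
    rw [← h2]
    exact statePath_eq ht.ge (ht ▸ jumpTime_lt_succ hω (n + 1))
  rw [← ht]
  refine iInf₂_le t ⟨ht0, fun hev => ?_, hx⟩
  have : (𝓝[<] t).NeBot := nhdsLT_neBot_of_exists_lt ⟨s, hst⟩
  -- Throughout `[s, t)` the path sits in the previous state, which differs from `x`; hence `t` is a
  -- genuine jump into `x`.
  have hmem : Set.Ico s t ∈ 𝓝[<] t := Ico_mem_nhdsLT hst
  obtain ⟨u, hu1, hu2⟩ := (hev.and hmem).exists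
  rw [hx, statePath_eq (n := n) (hs ▸ by exact_mod_cast hu2.1) (ht ▸ by exact_mod_cast hu2.2)]
    at hu1
  exact h1 (Option.some_injective _ hu1)

/-- The indicator that a finite trajectory does not visit `x` after time `0`. -/
def avoidInd (x : S) (n : ℕ) : ((_ : Finset.Iic n) → S × ℝ≥0∞) → ℝ≥0∞ :=
  Set.indicator {p | ∀ i : Finset.Iic n, i.1 ≠ 0 → (p i).1 ≠ x} 1

lemma avoidInd_eq_one {x : S} {n : ℕ} (h : ∀ i ≤ n, i ≠ 0 → (ω i).1 ≠ x) :
    avoidInd x n (Preorder.frestrictLe n ω) = 1 :=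
  Set.indicator_of_mem (by
    rintro ⟨i, hi⟩ h0
    exact h i (Finset.mem_Iic.1 hi) h0) _

lemma avoidInd_eq_zero {x : S} {n i : ℕ} (hi : i ≤ n) (h0 : i ≠ 0) (h : (ω i).1 = x) :
    avoidInd x n (Preorder.frestrictLe n ω) = 0 :=
  Set.indicator_of_notMem (by
    intro h'
    exact h' ⟨i, Finset.mem_Iic.2 hi⟩ h0 h) _

lemma avoidInd_succ_le (x : S) (n : ℕ) (ω : ℕ → S × ℝ≥0∞) :
    avoidInd x (n + 1) (Preorder.frestrictLe (n + 1) ω) ≤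
      avoidInd x n (Preorder.frestrictLe n ω) *
        ({x}ᶜ : Set S).indicator 1 (ω (n + 1)).1 := by
  by_cases h : ∀ i ≤ n + 1, i ≠ 0 → (ω i).1 ≠ x
  · rw [avoidInd_eq_one h, avoidInd_eq_one fun i hi => h i (hi.trans n.le_succ),
      Set.indicator_of_mem (h (n + 1) le_rfl n.succ_ne_zero)]
    simp
  · push Not at h
    obtain ⟨i, hi, h0, h⟩ := h
    rw [avoidInd_eq_zero hi h0 h]
    exact zero_le

/-- The mean-return-time functional dominates the return time on every trajectory that returns. -/
lemma returnTime_le_tsum (hω : ∀ k, (ω k).2 ≠ 0 ∧ (ω k).2 ≠ ∞) {x : S}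
    (h1 : (ω 1).1 ≠ x) (hex : ∃ n, n ≠ 0 ∧ (ω n).1 = x) :
    returnTime x ω ≤ ∑' n, avoidInd x n (Preorder.frestrictLe n ω) * (ω n).2 := by
  classical
  obtain ⟨hn0, hn⟩ := Nat.find_spec hex
  have hmin : ∀ i < Nat.find hex, i ≠ 0 → (ω i).1 ≠ x := fun i hi h0 h =>
    Nat.find_min hex hi ⟨h0, h⟩
  generalize Nat.find hex = n at *
  obtain ⟨m, rfl⟩ := Nat.exists_eq_succ_of_ne_zero hn0
  -- Minimality says nothing about time `0`, where the path may already be at `x`; the state before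
  -- the return must therefore have a positive index.
  have hm0 : m ≠ 0 := by rintro rfl; exact h1 hn
  refine (returnTime_le_jumpTime hω (hmin m (Nat.lt_succ_self m) hm0) hn).trans ?_
  refine le_trans (le_of_eq ?_) (ENNReal.sum_le_tsum (Finset.range (m + 1)))
  refine Finset.sum_congr rfl fun k hk => ?_
  rw [avoidInd_eq_one fun i hi => hmin i (by simp at hk; omega), one_mul]

variable [MeasurableSpace S] [MeasurableSingletonClass S]

lemma measurable_avoidInd (x : S) (n : ℕ) : Measurable (avoidInd x n) := by
  refine measurable_one.indicator ?_
  have : {p : (_ : Finset.Iic n) → S × ℝ≥0∞ | ∀ i : Finset.Iic n, i.1 ≠ 0 → (p i).1 ≠ x}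
      = ⋂ i : Finset.Iic n, ⋂ _ : i.1 ≠ 0, (fun p => (p i).1) ⁻¹' {x}ᶜ := by
    ext p; simp
  rw [this]
  refine MeasurableSet.iInter fun i => MeasurableSet.iInter fun _ => ?_
  exact (by fun_prop : Measurable fun p : (_ : Finset.Iic n) → S × ℝ≥0∞ => (p i).1)
    (measurableSet_singleton x).compl

lemma measurable_avoidInd_frestrictLe (x : S) (n : ℕ) :
    Measurable fun ω : ℕ → S × ℝ≥0∞ => avoidInd x n (Preorder.frestrictLe n ω) :=
  (measurable_avoidInd x n).comp (by fun_prop)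

end PathLemmas

/-! ### Return times and irreducibility from the jump chain. -/

section Recurrence

variable {S : Type*} [MeasurableSpace S] [Countable S] [MeasurableSingletonClass S]
  {q : S → S → ℝ}

lemma lintegral_processLaw_zero (q : S → S → ℝ) (x : S) {g : S × ℝ≥0∞ → ℝ≥0∞}
    (hg : Measurable g) :
    ∫⁻ ω, g (ω 0) ∂(processLaw q x) = ∫⁻ h, g (x, h) ∂(holdingLaw q x) := by
  rw [← lintegral_stateHoldingLaw q x hg, ← processLaw_map_zero,
    lintegral_map hg (by fun_prop)]

lemma lintegral_processLaw_succ' (q : S → S → ℝ) (x : S) (n : ℕ)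
    {g : S × ℝ≥0∞ → ℝ≥0∞} (hg : Measurable g) :
    ∫⁻ ω, g (ω (n + 1)) ∂(processLaw q x)
      = ∫⁻ ω, ∫⁻ y, ∫⁻ h, g (y, h) ∂(holdingLaw q y) ∂(jumpLaw q (ω n).1)
        ∂(processLaw q x) := by
  simpa using lintegral_processLaw_succ q x n (F := fun _ => 1) measurable_const hg

lemma measurable_comp_state (g : S → ℝ≥0∞) (n : ℕ) :
    Measurable fun ω : ℕ → S × ℝ≥0∞ => g (ω n).1 :=
  (Measurable.of_discrete (f := g)).comp (by fun_prop)

lemma ae_holding (hq : ∀ y, exitRate q y ≠ 0 ∧ exitRate q y ≠ ∞) (x : S) :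
    ∀ᵐ ω ∂(processLaw q x), ∀ k, (ω k).2 ≠ 0 ∧ (ω k).2 ≠ ∞ := by
  rw [ae_all_iff]
  have hB : MeasurableSet ({0, ∞} : Set ℝ≥0∞) := (Set.toFinite _).measurableSet
  set g : S × ℝ≥0∞ → ℝ≥0∞ := fun p => ({0, ∞} : Set ℝ≥0∞).indicator 1 p.2 with hgdef
  have hg : Measurable g := (measurable_one.indicator hB).comp measurable_snd
  have h0 : ∀ y, ∫⁻ h, g (y, h) ∂(holdingLaw q y) = 0 := by
    intro y
    rw [lintegral_eq_zero_iff (by fun_prop)]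
    filter_upwards [ae_holdingLaw (hq y).1 (hq y).2] with h hh
    simp [hgdef, hh.1, hh.2]
  intro k
  have hk : ∫⁻ ω, g (ω k) ∂(processLaw q x) = 0 := by
    cases k with
    | zero => rw [lintegral_processLaw_zero q x hg, h0]
    | succ n => rw [lintegral_processLaw_succ' q x n hg]; simp [h0]
  rw [lintegral_eq_zero_iff (by fun_prop)] at hk
  filter_upwards [hk] with ω hω
  by_contra hcon
  have : (ω k).2 ∈ ({0, ∞} : Set ℝ≥0∞) := by
    simp only [Set.mem_insert_iff, Set.mem_singleton_iff]
    tauto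
  simp [hgdef, Set.indicator_of_mem this] at hω

lemma lintegral_state_zero (q : S → S → ℝ) (x : S) (g : S → ℝ≥0∞) :
    ∫⁻ ω, g (ω 0).1 ∂(processLaw q x) = g x := by
  rw [lintegral_processLaw_zero q x (g := fun p => g p.1)
    ((Measurable.of_discrete (f := g)).comp measurable_fst)]
  simp

lemma lintegral_state_succ (q : S → S → ℝ) (x : S) (n : ℕ) (g : S → ℝ≥0∞) :
    ∫⁻ ω, g (ω (n + 1)).1 ∂(processLaw q x)
      = ∫⁻ ω, ∫⁻ y, g y ∂(jumpLaw q (ω n).1) ∂(processLaw q x) := by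
  rw [lintegral_processLaw_succ' q x n (g := fun p => g p.1)
    ((Measurable.of_discrete (f := g)).comp measurable_fst)]
  simp

lemma ae_state_one_ne (hq : ∀ y, exitRate q y ≠ 0 ∧ exitRate q y ≠ ∞) (x : S) :
    ∀ᵐ ω ∂(processLaw q x), (ω 1).1 ≠ x := by
  have h := lintegral_state_succ q x 0 (({x} : Set S).indicator 1)
  simp only [lintegral_indicator_one (measurableSet_singleton x)] at h
  have h0 : offDiagRate q x x = 0 := if_pos rfl
  rw [lintegral_state_zero q x (fun y => jumpLaw q y {x}), jumpLaw_singleton (hq x).1 (hq x).2,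
    h0, zero_mul, lintegral_eq_zero_iff (measurable_comp_state _ _)] at h
  filter_upwards [h] with ω hω h1
  simp [h1] at hω

/-- If `P W + 1 / q + f ≤ W` off `x`, then one step decreases the expected potential by the
expected cost. -/
lemma lintegral_avoidInd_step {x : S} (hq : ∀ y, exitRate q y ≠ 0 ∧ exitRate q y ≠ ∞)
    {W f : S → ℝ≥0∞}
    (hW : ∀ y, y ≠ x → (exitRate q y)⁻¹ + (f y + ∫⁻ z, W z ∂(jumpLaw q y)) ≤ W y) (n : ℕ) :
    ∫⁻ ω, avoidInd x (n + 1) (Preorder.frestrictLe (n + 1) ω) *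
        ((ω (n + 1)).2 + (f (ω (n + 1)).1 + ∫⁻ z, W z ∂(jumpLaw q (ω (n + 1)).1)))
        ∂(processLaw q x)
      ≤ ∫⁻ ω, avoidInd x n (Preorder.frestrictLe n ω) * ∫⁻ z, W z ∂(jumpLaw q (ω n).1)
        ∂(processLaw q x) := by
  set G : S → ℝ≥0∞ := fun y => f y + ∫⁻ z, W z ∂(jumpLaw q y) with hG
  set g : S × ℝ≥0∞ → ℝ≥0∞ := fun p => ({x}ᶜ : Set S).indicator 1 p.1 * (p.2 + G p.1) with hgdef
  have hGm : Measurable fun p : S × ℝ≥0∞ => G p.1 := (Measurable.of_discrete (f := G)).comp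
    measurable_fst
  have hg : Measurable g :=
    ((Measurable.of_discrete (f := ({x}ᶜ : Set S).indicator (1 : S → ℝ≥0∞))).comp
      measurable_fst).mul (measurable_snd.add hGm)
  calc _ ≤ ∫⁻ ω, avoidInd x n (Preorder.frestrictLe n ω) * g (ω (n + 1)) ∂(processLaw q x) := by
        refine lintegral_mono fun ω => ?_
        rw [hgdef, ← mul_assoc]
        exact mul_le_mul_left (avoidInd_succ_le x n ω) _
    _ = _ := lintegral_processLaw_succ q x n (measurable_avoidInd x n) hg
    _ ≤ _ := by
        refine lintegral_mono fun ω => mul_le_mul_right (lintegral_mono fun y => ?_) _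
        by_cases hy : y = x
        · simp [hgdef, hy]
        · have : ∀ h, g (y, h) = h + G y := fun h => by simp [hgdef, hy]
          simp only [this]
          rw [lintegral_add_right _ measurable_const, lintegral_holdingLaw (hq y).1 (hq y).2]
          simpa using hW y hy

/-- The potential of the process killed on return to `x`, plus the costs already paid, is a
supermartingale; the one-step bounds telescope. The starting value is `PW(x)`, not `W(x)`, because
nothing is assumed at `x` itself. -/
lemma lintegral_avoidInd_potential_le {x : S}
    (hq : ∀ y, exitRate q y ≠ 0 ∧ exitRate q y ≠ ∞) {W f : S → ℝ≥0∞}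
    (hW : ∀ y, y ≠ x → (exitRate q y)⁻¹ + (f y + ∫⁻ z, W z ∂(jumpLaw q y)) ≤ W y) (n : ℕ) :
    ∑ k ∈ Finset.range n, ∫⁻ ω, avoidInd x (k + 1) (Preorder.frestrictLe (k + 1) ω) *
        ((ω (k + 1)).2 + f (ω (k + 1)).1) ∂(processLaw q x)
      + ∫⁻ ω, avoidInd x n (Preorder.frestrictLe n ω) * ∫⁻ z, W z ∂(jumpLaw q (ω n).1)
        ∂(processLaw q x)
      ≤ ∫⁻ z, W z ∂(jumpLaw q x) := by
  induction n with
  | zero =>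
    rw [Finset.range_zero, Finset.sum_empty, zero_add]
    refine le_trans (lintegral_mono fun ω => ?_)
      (lintegral_state_zero q x fun y => ∫⁻ z, W z ∂(jumpLaw q y)).le
    rw [avoidInd_eq_one (by intro i hi h0; omega), one_mul]
  | succ n ih =>
    refine le_trans ?_ ih
    rw [Finset.sum_range_succ, add_assoc]
    gcongr
    refine le_trans (le_of_eq ?_) (lintegral_avoidInd_step hq hW n)
    have hm : Measurable fun ω : ℕ → S × ℝ≥0∞ =>
        avoidInd x (n + 1) (Preorder.frestrictLe (n + 1) ω) *
          ∫⁻ z, W z ∂(jumpLaw q (ω (n + 1)).1) :=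
      (measurable_avoidInd_frestrictLe x _).mul
        (measurable_comp_state (fun y => ∫⁻ z, W z ∂(jumpLaw q y)) _)
    rw [← lintegral_add_right _ hm]
    refine lintegral_congr fun ω => ?_
    ring

lemma tsum_lintegral_avoidInd_le {x : S}
    (hq : ∀ y, exitRate q y ≠ 0 ∧ exitRate q y ≠ ∞) {W f : S → ℝ≥0∞}
    (hW : ∀ y, y ≠ x → (exitRate q y)⁻¹ + (f y + ∫⁻ z, W z ∂(jumpLaw q y)) ≤ W y) :
    ∑' k, ∫⁻ ω, avoidInd x (k + 1) (Preorder.frestrictLe (k + 1) ω) *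
        ((ω (k + 1)).2 + f (ω (k + 1)).1) ∂(processLaw q x)
      ≤ ∫⁻ z, W z ∂(jumpLaw q x) :=
  ENNReal.tsum_le_of_sum_range_le fun n =>
    le_self_add.trans (lintegral_avoidInd_potential_le hq hW n)

/-- The process started at `x` returns to `x` almost surely if there is a potential with finite
sublevel sets that decreases off `x`. -/
lemma ae_exists_return {x : S}
    (hq : ∀ y, exitRate q y ≠ 0 ∧ exitRate q y ≠ ∞) {W f : S → ℝ≥0∞}
    (hW : ∀ y, y ≠ x → (exitRate q y)⁻¹ + (f y + ∫⁻ z, W z ∂(jumpLaw q y)) ≤ W y)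
    (hx : ∫⁻ z, W z ∂(jumpLaw q x) ≠ ∞) (hf : ∀ y, f y ≠ 0)
    (hfin : ∀ M : ℝ≥0, {y | W y ≤ M}.Finite) :
    ∀ᵐ ω ∂(processLaw q x), ∃ n, n ≠ 0 ∧ (ω n).1 = x := by
  set B := ∫⁻ z, W z ∂(jumpLaw q x) with hB
  set μ := processLaw q x with hμ
  set D : Set (ℕ → S × ℝ≥0∞) := {ω | ¬ ∃ n, n ≠ 0 ∧ (ω n).1 = x} with hD
  set e : ℕ → ℝ≥0∞ := fun k => ∫⁻ ω, avoidInd x (k + 1) (Preorder.frestrictLe (k + 1) ω) *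
        f (ω (k + 1)).1 ∂μ with he
  have he0 : Tendsto e atTop (𝓝 0) := by
    refine ENNReal.tendsto_atTop_zero_of_tsum_ne_top (ne_top_of_le_ne_top hx ?_)
    refine le_trans (ENNReal.tsum_le_tsum fun k => lintegral_mono fun ω => ?_)
      (tsum_lintegral_avoidInd_le hq hW)
    gcongr
    exact le_add_self
  have hw : ∀ n, ∫⁻ ω, avoidInd x (n + 1) (Preorder.frestrictLe (n + 1) ω) *
      W (ω (n + 1)).1 ∂μ ≤ B := by
    intro n
    have hWm : Measurable fun p : S × ℝ≥0∞ => W p.1 :=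
      (Measurable.of_discrete (f := W)).comp measurable_fst
    calc _ ≤ ∫⁻ ω, avoidInd x n (Preorder.frestrictLe n ω) * W (ω (n + 1)).1 ∂μ := by
          refine lintegral_mono fun ω => mul_le_mul_left ((avoidInd_succ_le x n ω).trans ?_) _
          refine mul_le_of_le_one_right' (Set.indicator_le_self' (by simp) _)
      _ = ∫⁻ ω, avoidInd x n (Preorder.frestrictLe n ω) * ∫⁻ z, W z ∂(jumpLaw q (ω n).1) ∂μ := by
          have := lintegral_processLaw_succ q x n (measurable_avoidInd x n) hWm
          simpa using this
      _ ≤ _ := le_add_self.trans (lintegral_avoidInd_potential_le hq hW n)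
  -- On `{W ≤ M}`, a finite set, `f` is bounded below, and the summable costs make a surviving path
  -- unlikely to be there at late times. Outside it Markov's inequality gives `B / M`.
  have hle : ∀ M : ℝ≥0, M ≠ 0 → μ D ≤ (M : ℝ≥0∞)⁻¹ * B := by
    intro M hM
    obtain ⟨δ, hδ0, hδ1, hδ⟩ : ∃ δ : ℝ≥0∞, δ ≠ 0 ∧ δ ≠ ∞ ∧ ∀ y, W y ≤ M → δ ≤ f y := by
      -- The cap by `1` keeps `δ` finite, in particular when the sublevel set is empty and the
      -- infimum is `∞`.
      refine ⟨(hfin M).toFinset.inf f ⊓ 1, ne_of_gt (lt_inf_iff.2 ⟨?_, one_pos⟩),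
        ne_top_of_le_ne_top ENNReal.one_ne_top inf_le_right, fun y hy => ?_⟩
      · exact (Finset.lt_inf_iff ENNReal.zero_lt_top).2 fun y _ => pos_iff_ne_zero.2 (hf y)
      · exact inf_le_left.trans (Finset.inf_le (by simpa using hy))
    have hpt : ∀ y, 1 ≤ δ⁻¹ * f y + (M : ℝ≥0∞)⁻¹ * W y := by
      intro y
      rcases le_total (W y) M with h | h
      · refine le_trans ?_ le_self_add
        rw [← ENNReal.inv_mul_cancel hδ0 hδ1]
        gcongr
        exact hδ y h
      · refine le_trans ?_ le_add_self
        rw [← ENNReal.inv_mul_cancel (ENNReal.coe_ne_zero.2 hM) ENNReal.coe_ne_top]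
        gcongr
    have hn : ∀ n, μ D ≤ δ⁻¹ * e n + (M : ℝ≥0∞)⁻¹ * B := by
      intro n
      calc μ D ≤ ∫⁻ ω, avoidInd x (n + 1) (Preorder.frestrictLe (n + 1) ω) ∂μ := by
            have hD1 : D ⊆ {ω | 1 ≤ avoidInd x (n + 1) (Preorder.frestrictLe (n + 1) ω)} :=
              fun ω hω => (avoidInd_eq_one fun i _ h0 h => hω ⟨i, h0, h⟩).ge
            refine (measure_mono hD1).trans ?_
            simpa using mul_meas_ge_le_lintegral (μ := μ)
              (measurable_avoidInd_frestrictLe x (n + 1)) 1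
        _ ≤ ∫⁻ ω, (δ⁻¹ * (avoidInd x (n + 1) (Preorder.frestrictLe (n + 1) ω) *
                f (ω (n + 1)).1) + (M : ℝ≥0∞)⁻¹ *
              (avoidInd x (n + 1) (Preorder.frestrictLe (n + 1) ω) * W (ω (n + 1)).1)) ∂μ := by
            refine lintegral_mono fun ω => ?_
            calc _ = avoidInd x (n + 1) (Preorder.frestrictLe (n + 1) ω) * 1 := (mul_one _).symm
              _ ≤ _ := mul_le_mul_right (hpt (ω (n + 1)).1) _
              _ = _ := by ring
        _ ≤ _ := by
            have hm1 : Measurable fun ω : ℕ → S × ℝ≥0∞ =>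
                avoidInd x (n + 1) (Preorder.frestrictLe (n + 1) ω) * f (ω (n + 1)).1 :=
              (measurable_avoidInd_frestrictLe x _).mul (measurable_comp_state f _)
            have hm2 : Measurable fun ω : ℕ → S × ℝ≥0∞ =>
                avoidInd x (n + 1) (Preorder.frestrictLe (n + 1) ω) * W (ω (n + 1)).1 :=
              (measurable_avoidInd_frestrictLe x _).mul (measurable_comp_state W _)
            rw [lintegral_add_left (hm1.const_mul _), lintegral_const_mul _ hm1,
              lintegral_const_mul _ hm2]
            gcongr
            exact hw n
    have hlim : Tendsto (fun n => δ⁻¹ * e n + (M : ℝ≥0∞)⁻¹ * B) atTop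
        (𝓝 (δ⁻¹ * 0 + (M : ℝ≥0∞)⁻¹ * B)) :=
      (ENNReal.Tendsto.const_mul he0 (Or.inr (ENNReal.inv_ne_top.2 hδ0))).add_const _
    simpa using ge_of_tendsto' hlim hn
  have hlim : Tendsto (fun n : ℕ => (((n : ℝ≥0) : ℝ≥0∞))⁻¹ * B) atTop (𝓝 (0 * B)) := by
    refine ENNReal.Tendsto.mul_const ?_ (Or.inr hx)
    simpa using ENNReal.tendsto_inv_nat_nhds_zero
  have h0 : μ D ≤ 0 * B := by
    refine ge_of_tendsto hlim ?_
    filter_upwards [eventually_ne_atTop 0] with n hn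
    exact hle n (by exact_mod_cast hn)
  rw [zero_mul] at h0
  exact ae_iff.2 (nonpos_iff_eq_zero.1 h0)

/-- A Foster type criterion for a finite mean return time to `x`. -/
theorem lintegral_returnTime_lt_top {x : S}
    (hq : ∀ y, exitRate q y ≠ 0 ∧ exitRate q y ≠ ∞) {W f : S → ℝ≥0∞}
    (hW : ∀ y, y ≠ x → (exitRate q y)⁻¹ + (f y + ∫⁻ z, W z ∂(jumpLaw q y)) ≤ W y)
    (hx : ∫⁻ z, W z ∂(jumpLaw q x) ≠ ∞) (hf : ∀ y, f y ≠ 0)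
    (hfin : ∀ M : ℝ≥0, {y | W y ≤ M}.Finite) :
    ∫⁻ ω, returnTime x ω ∂(processLaw q x) < ∞ := by
  have hm : ∀ n, Measurable fun ω : ℕ → S × ℝ≥0∞ =>
      avoidInd x n (Preorder.frestrictLe n ω) * (ω n).2 := fun n =>
    (measurable_avoidInd_frestrictLe x n).mul (by fun_prop)
  calc ∫⁻ ω, returnTime x ω ∂(processLaw q x)
      ≤ ∫⁻ ω, ∑' n, avoidInd x n (Preorder.frestrictLe n ω) * (ω n).2 ∂(processLaw q x) := by
        refine lintegral_mono_ae ?_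
        filter_upwards [ae_holding hq x, ae_state_one_ne hq x,
          ae_exists_return hq hW hx hf hfin] with ω h1 h2 h3
        exact returnTime_le_tsum h1 h2 h3
    _ = ∑' n, ∫⁻ ω, avoidInd x n (Preorder.frestrictLe n ω) * (ω n).2 ∂(processLaw q x) :=
        lintegral_tsum fun n => (hm n).aemeasurable
    _ ≤ (exitRate q x)⁻¹ + ∫⁻ z, W z ∂(jumpLaw q x) := by
        -- The initial stay in `x` is split off, since the potential inequality only pays for states
        -- other than `x`.
        rw [tsum_eq_zero_add' ENNReal.summable]
        refine add_le_add ?_ (le_trans (ENNReal.tsum_le_tsum fun k => lintegral_mono fun ω => ?_)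
          (tsum_lintegral_avoidInd_le hq hW))
        · rw [← lintegral_holdingLaw (hq x).1 (hq x).2,
            ← lintegral_processLaw_zero q x measurable_snd]
          refine lintegral_mono fun ω => ?_
          rw [avoidInd_eq_one (by intro i hi h0; omega), one_mul]
        · gcongr
          exact le_self_add
    _ < ∞ := ENNReal.add_lt_top.2
        ⟨ENNReal.inv_lt_top.2 (pos_iff_ne_zero.2 (hq x).1), hx.lt_top⟩

/-- Along a chain of positive rates, each jump multiplies a lower bound for the probability by a
positive factor. -/
lemma processLaw_state_pos (hq : ∀ y, exitRate q y ≠ 0 ∧ exitRate q y ≠ ∞) {x y : S}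
    (h : Relation.ReflTransGen (fun a b => a ≠ b ∧ 0 < q a b) x y) :
    ∃ n, ∫⁻ ω, ({y} : Set S).indicator 1 (ω n).1 ∂(processLaw q x) ≠ 0 := by
  induction h with
  | refl => exact ⟨0, by rw [lintegral_state_zero]; simp⟩
  | @tail b c _ hbc ih =>
    obtain ⟨n, hn⟩ := ih
    refine ⟨n + 1, ?_⟩
    rw [lintegral_state_succ]
    simp only [lintegral_indicator_one (measurableSet_singleton c)]
    have hp : jumpLaw q b {c} ≠ 0 := by
      rw [jumpLaw_singleton (hq b).1 (hq b).2]
      refine mul_ne_zero ?_ (ENNReal.inv_ne_zero.2 (hq b).2)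
      rw [offDiagRate, if_neg hbc.1.symm]
      simpa using hbc.2
    refine ne_of_gt (lt_of_lt_of_le (pos_iff_ne_zero.2 (mul_ne_zero hn hp)) ?_)
    rw [← lintegral_mul_const _ (measurable_comp_state _ n)]
    refine lintegral_mono fun ω => ?_
    by_cases h : (ω n).1 = b <;> simp [h]

theorem isIrreducibleProcess_of_reflTransGen
    (hq : ∀ y, exitRate q y ≠ 0 ∧ exitRate q y ≠ ∞)
    (h : ∀ x y, Relation.ReflTransGen (fun a b => a ≠ b ∧ 0 < q a b) x y) :
    IsIrreducibleProcess q := by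
  intro x y
  obtain ⟨n, hn⟩ := processLaw_state_pos hq (h x y)
  have hm : MeasurableSet {ω : ℕ → S × ℝ≥0∞ | (ω n).1 = y} :=
    (by fun_prop : Measurable fun ω : ℕ → S × ℝ≥0∞ => (ω n).1) (measurableSet_singleton y)
  have : processLaw q x {ω | (ω n).1 = y} ≠ 0 := by
    rw [← lintegral_indicator_one hm]
    exact hn
  refine lt_of_lt_of_le (pos_iff_ne_zero.2 this) (measure_mono_ae ?_)
  filter_upwards [ae_holding hq x] with ω hω hy
  obtain ⟨t, ht⟩ := exists_statePath_eq hω n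
  exact ⟨t, ht.trans (congrArg some hy)⟩

end Recurrence

/-! ### Foster's theorem for locally finite rates. -/

section LocallyFinite

variable {S : Type*} {q : S → S → ℝ} {N : S → Finset S}

lemma hasSum_meanDrift (hN : ∀ x y, y ≠ x → y ∉ N x → q x y = 0)
    (V : S → ℝ) (x : S) :
    HasSum (fun y : {y : S // y ≠ x} => (V y - V x) * q x y)
      (∑ y ∈ N x, (V y - V x) * q x y) := by
  have h : HasSum (fun y : S => (V y - V x) * q x y) (∑ y ∈ N x, (V y - V x) * q x y) := by
    refine hasSum_sum_of_ne_finset_zero fun y hy => ?_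
    rcases eq_or_ne y x with rfl | hyx
    · simp
    · rw [hN x y hyx hy, mul_zero]
  refine (hasSum_subtype_iff_of_support_subset (s := {y | y ≠ x}) ?_).2 h
  rintro y hy rfl
  simp at hy

lemma meanDrift_eq_sum (hN : ∀ x y, y ≠ x → y ∉ N x → q x y = 0)
    (V : S → ℝ) (x : S) :
    meanDrift q V x = ∑ y ∈ N x, (V y - V x) * q x y :=
  (hasSum_meanDrift hN V x).tsum_eq

lemma summable_meanDrift_abs (hN : ∀ x y, y ≠ x → y ∉ N x → q x y = 0)
    (V : S → ℝ) (x : S) :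
    Summable fun y : {y : S // y ≠ x} => |V y - V x| * q x y := by
  have h : Summable fun y : S => |V y - V x| * q x y := by
    refine (hasSum_sum_of_ne_finset_zero (s := N x) fun y hy => ?_).summable
    rcases eq_or_ne y x with rfl | hyx
    · simp
    · rw [hN x y hyx hy, mul_zero]
  exact h.subtype _

lemma tsum_offDiagRate_mul (hq : ∀ x y, 0 ≤ q x y) (hNx : ∀ x, x ∉ N x)
    (hN : ∀ x y, y ≠ x → y ∉ N x → q x y = 0) {W : S → ℝ} (hW : ∀ y, 0 ≤ W y) (x : S) :
    ∑' y, offDiagRate q x y * ENNReal.ofReal (W y)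
      = ENNReal.ofReal (∑ y ∈ N x, q x y * W y) := by
  rw [ENNReal.ofReal_sum_of_nonneg fun y _ => mul_nonneg (hq x y) (hW y), tsum_eq_sum (s := N x)]
  · refine Finset.sum_congr rfl fun y hy => ?_
    rw [offDiagRate, if_neg (by rintro rfl; exact hNx _ hy), ENNReal.ofReal_mul (hq x y)]
  · intro y hy
    rcases eq_or_ne y x with rfl | hyx
    · simp [offDiagRate]
    · simp [offDiagRate, hN x y hyx hy]

lemma exitRate_eq_sum (hq : ∀ x y, 0 ≤ q x y) (hNx : ∀ x, x ∉ N x)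
    (hN : ∀ x y, y ≠ x → y ∉ N x → q x y = 0) (x : S) :
    exitRate q x = ENNReal.ofReal (∑ y ∈ N x, q x y) := by
  simpa [exitRate] using tsum_offDiagRate_mul hq hNx hN (W := fun _ => 1) (fun _ => zero_le_one) x

open Classical in
/-- The expectation of `2 ^ (-σ)` on `{σ ≤ n}`, where `σ` is the number of jumps before `x` is
visited. -/
def discountedHit (q : S → S → ℝ) (N : S → Finset S) (x : S) : ℕ → S → ℝ
  | 0, y => if y = x then 1 else 0
  | n + 1, y => if y = x then 1 else
      (2 * ∑ z ∈ N y, q y z)⁻¹ * ∑ z ∈ N y, q y z * discountedHit q N x n z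

lemma discountedHit_nonneg (hq : ∀ x y, 0 ≤ q x y) (x : S) (n : ℕ) (y : S) :
    0 ≤ discountedHit q N x n y := by
  induction n generalizing y with
  | zero => rw [discountedHit]; split_ifs <;> norm_num
  | succ n ih =>
    rw [discountedHit]
    split_ifs
    · norm_num
    · exact mul_nonneg (inv_nonneg.2 (mul_nonneg two_pos.le (Finset.sum_nonneg fun z _ => hq y z)))
        (Finset.sum_nonneg fun z _ => mul_nonneg (hq y z) (ih z))

lemma discountedHit_le_one (hq : ∀ x y, 0 ≤ q x y) (hR : ∀ y, 0 < ∑ z ∈ N y, q y z)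
    (x : S) (n : ℕ) (y : S) : discountedHit q N x n y ≤ 1 := by
  induction n generalizing y with
  | zero => rw [discountedHit]; split_ifs <;> norm_num
  | succ n ih =>
    rw [discountedHit]
    split_ifs
    · norm_num
    · have := hR y
      rw [inv_mul_le_iff₀ (by positivity), mul_one]
      have : ∑ z ∈ N y, q y z * discountedHit q N x n z ≤ ∑ z ∈ N y, q y z :=
        Finset.sum_le_sum fun z _ => mul_le_of_le_one_right (hq y z) (ih z)
      linarith

lemma monotone_discountedHit (hq : ∀ x y, 0 ≤ q x y) (x y : S) :
    Monotone fun n => discountedHit q N x n y := by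
  refine monotone_nat_of_le_succ fun n => ?_
  induction n generalizing y with
  | zero =>
    by_cases h : y = x
    · simp [discountedHit, h]
    · rw [discountedHit, if_neg h]
      exact discountedHit_nonneg hq x _ y
  | succ n ih =>
    rw [discountedHit, discountedHit]
    split_ifs
    · exact le_rfl
    · have : 0 ≤ ∑ z ∈ N y, q y z := Finset.sum_nonneg fun z _ => hq y z
      exact mul_le_mul_of_nonneg_left (Finset.sum_le_sum fun z _ =>
        mul_le_mul_of_nonneg_left (ih z) (hq y z)) (by positivity)

lemma exists_discountedHit_pos (hq : ∀ x y, 0 ≤ q x y) (hR : ∀ y, 0 < ∑ z ∈ N y, q y z)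
    (hN : ∀ x y, y ≠ x → y ∉ N x → q x y = 0) {x y : S}
    (h : Relation.ReflTransGen (fun a b => a ≠ b ∧ 0 < q a b) y x) :
    ∃ n, 0 < discountedHit q N x n y := by
  induction h using Relation.ReflTransGen.head_induction_on with
  | refl => exact ⟨0, by simp [discountedHit]⟩
  | @head a b hab _ ih =>
    obtain ⟨n, hn⟩ := ih
    refine ⟨n + 1, ?_⟩
    rw [discountedHit]
    split_ifs
    · norm_num
    · have hb : b ∈ N a := by
        by_contra hb
        exact hab.2.ne' (hN a b hab.1.symm hb)
      have := hR a
      refine mul_pos (by positivity) (lt_of_lt_of_le (mul_pos hab.2 hn) ?_)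
      exact Finset.single_le_sum (f := fun z => q a z * discountedHit q N x n z)
        (fun z _ => mul_nonneg (hq a z) (discountedHit_nonneg hq x n z)) hb

/-- The increasing limit of `discountedHit` is `E 2^(-σ)`, and the identity is its first-step
equation. Discounting makes `-f` have strictly negative drift at every state other than `x`, which
is what allows a correction on a finite set. -/
lemma exists_discounted_potential (hq : ∀ x y, 0 ≤ q x y) (hR : ∀ y, 0 < ∑ z ∈ N y, q y z)
    (hN : ∀ x y, y ≠ x → y ∉ N x → q x y = 0) {x : S}
    (hirr : ∀ y, Relation.ReflTransGen (fun a b => a ≠ b ∧ 0 < q a b) y x) :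
    ∃ f : S → ℝ, (∀ y, 0 < f y) ∧ (∀ y, f y ≤ 1) ∧
      ∀ y, y ≠ x → ∑ z ∈ N y, q y z * f z = 2 * (∑ z ∈ N y, q y z) * f y := by
  have hb : ∀ y, BddAbove (Set.range fun n => discountedHit q N x n y) := fun y =>
    ⟨1, by rintro _ ⟨n, rfl⟩; exact discountedHit_le_one hq hR x n y⟩
  have hlim : ∀ y, Tendsto (fun n => discountedHit q N x n y) atTop
      (𝓝 (⨆ n, discountedHit q N x n y)) := fun y =>
    tendsto_atTop_ciSup (monotone_discountedHit hq x y) (hb y)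
  refine ⟨fun y => ⨆ n, discountedHit q N x n y, fun y => ?_,
    fun y => ciSup_le fun n => discountedHit_le_one hq hR x n y, fun y hy => ?_⟩
  · obtain ⟨n, hn⟩ := exists_discountedHit_pos hq hR hN (hirr y)
    exact hn.trans_le (le_ciSup (hb y) n)
  · have h1 : Tendsto (fun n => ∑ z ∈ N y, q y z * discountedHit q N x n z) atTop
        (𝓝 (∑ z ∈ N y, q y z * ⨆ n, discountedHit q N x n z)) :=
      tendsto_finsetSum _ fun z _ => (hlim z).const_mul _
    have h2 : Tendsto (fun n => 2 * (∑ z ∈ N y, q y z) * discountedHit q N x (n + 1) y) atTop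
        (𝓝 (2 * (∑ z ∈ N y, q y z) * ⨆ n, discountedHit q N x n y)) :=
      ((tendsto_add_atTop_iff_nat 1).2 (hlim y)).const_mul _
    refine tendsto_nhds_unique h1 (h2.congr fun n => ?_)
    have := hR y
    rw [discountedHit, if_neg hy]
    field_simp

lemma IsLyapunovFunction.exists_drift_le {V : S → ℝ} (hV : IsLyapunovFunction q V) :
    ∃ S₀ : Finset S, ∃ ε : ℝ, 0 < ε ∧ ∀ x, x ∉ S₀ → meanDrift q V x ≤ -ε := by
  obtain ⟨S₀, h⟩ := hV.drift
  obtain ⟨c, hc, hc0⟩ := EReal.lt_iff_exists_real_btwn.1 h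
  refine ⟨S₀, -c, by have : c < 0 := by exact_mod_cast hc0
                     linarith, fun x hx => ?_⟩
  have h1 : (meanDrift q V x : EReal) ≤ c :=
    (le_iSup₂ (f := fun x (_ : x ∈ {x : S | x ∉ S₀}) => (meanDrift q V x : EReal)) x hx).trans hc.le
  rw [neg_neg]
  exact_mod_cast h1

variable [MeasurableSpace S] [Countable S] [MeasurableSingletonClass S]

lemma lintegral_jumpLaw_ofReal (hq : ∀ x y, 0 ≤ q x y) (hNx : ∀ x, x ∉ N x)
    (hN : ∀ x y, y ≠ x → y ∉ N x → q x y = 0) (hR : ∀ y, 0 < ∑ z ∈ N y, q y z)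
    {W : S → ℝ} (hW : ∀ y, 0 ≤ W y) (x : S) :
    ∫⁻ y, ENNReal.ofReal (W y) ∂(jumpLaw q x)
      = ENNReal.ofReal ((∑ y ∈ N x, q x y)⁻¹ * ∑ y ∈ N x, q x y * W y) := by
  have he := exitRate_eq_sum hq hNx hN x
  rw [lintegral_jumpLaw (by rw [he]; simpa using hR x) (by rw [he]; exact ENNReal.ofReal_ne_top),
    tsum_offDiagRate_mul hq hNx hN hW, he, ← ENNReal.ofReal_inv_of_pos (hR x),
    ← ENNReal.ofReal_mul (inv_nonneg.2 (hR x).le)]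

/-- Foster's theorem: an irreducible process with locally finite rates and a Lyapunov function has
finite mean return times, hence is ergodic. -/
theorem IsLyapunovFunction.ergodic {V : S → ℝ} (hV : IsLyapunovFunction q V)
    (hq : ∀ x y, 0 ≤ q x y) (hNx : ∀ x, x ∉ N x)
    (hN : ∀ x y, y ≠ x → y ∉ N x → q x y = 0) (hR : ∀ y, 0 < ∑ z ∈ N y, q y z)
    (hirr : ∀ x y, Relation.ReflTransGen (fun a b => a ≠ b ∧ 0 < q a b) x y) :
    IsErgodicProcess q := by
  have he : ∀ y, exitRate q y ≠ 0 ∧ exitRate q y ≠ ∞ := fun y => by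
    rw [exitRate_eq_sum hq hNx hN y]
    exact ⟨by simpa using hR y, ENNReal.ofReal_ne_top⟩
  refine ⟨isIrreducibleProcess_of_reflTransGen he hirr, fun x => Or.inr ?_⟩
  obtain ⟨f, hf0, hf1, hf⟩ := exists_discounted_potential hq hR hN fun y => hirr y x
  obtain ⟨S₀, ε, hε, hdrift⟩ := hV.exists_drift_le
  -- Finiteness of `{V ≤ 0}` bounds `V` from below.
  obtain ⟨B, hB⟩ : ∃ B : ℝ, ∀ y, 0 ≤ V y + B := by
    obtain ⟨b, hb⟩ := ((hV.tendsto 0).image V).bddBelow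
    refine ⟨|b|, fun y => ?_⟩
    rcases le_total (V y) 0 with h | h
    · have := hb ⟨y, h, rfl⟩
      linarith [neg_abs_le b]
    · positivity
  set R : S → ℝ := fun y => ∑ z ∈ N y, q y z with hRdef
  have hRf : ∀ y, 0 < R y * f y := fun y => mul_pos (hR y) (hf0 y)
  have hterm : ∀ y, 0 ≤ (1 + ε⁻¹ * |meanDrift q V y|) / (R y * f y) := fun y =>
    div_nonneg (by positivity) (hRf y).le
  -- The term `-C f` contributes drift `-C R f` off `x`. The summand `1` of `C` pays for the cost `R
  -- f` everywhere; the sum absorbs the unit cost and any positive drift of `V` on `S₀`.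
  set C : ℝ := 1 + ∑ y ∈ S₀, (1 + ε⁻¹ * |meanDrift q V y|) / (R y * f y) with hC
  have hC1 : 1 ≤ C := le_add_of_nonneg_right (Finset.sum_nonneg fun y _ => hterm y)
  set W : S → ℝ := fun y => ε⁻¹ * (V y + B) + C * (1 - f y) with hWdef
  have hW0 : ∀ y, 0 ≤ W y := fun y => add_nonneg (mul_nonneg (by positivity) (hB y))
    (mul_nonneg (by linarith) (by linarith [hf1 y]))
  have hWsum : ∀ y, y ≠ x → 1 + R y * f y + ∑ z ∈ N y, q y z * W z ≤ R y * W y := by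
    intro y hy
    have h1 : ∑ z ∈ N y, q y z * W z
        = R y * W y + ε⁻¹ * meanDrift q V y - C * (R y * f y) := by
      have h2 : ∑ z ∈ N y, q y z * W z = R y * W y + ε⁻¹ * (∑ z ∈ N y, (V z - V y) * q y z)
          - C * (∑ z ∈ N y, q y z * f z - R y * f y) := by
        simp only [hRdef, hWdef, Finset.sum_mul, Finset.mul_sum, ← Finset.sum_sub_distrib,
          ← Finset.sum_add_distrib]
        refine Finset.sum_congr rfl fun z _ => ?_
        ring
      rw [h2, hf y hy, meanDrift_eq_sum hN]
      ring
    have h3 : 1 + R y * f y + ε⁻¹ * meanDrift q V y ≤ C * (R y * f y) := by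
      by_cases hyS : y ∈ S₀
      · have h4 : (1 + ε⁻¹ * |meanDrift q V y|) / (R y * f y) ≤ C - 1 := by
          rw [hC, add_sub_cancel_left]
          exact Finset.single_le_sum (f := fun y => (1 + ε⁻¹ * |meanDrift q V y|) / (R y * f y))
            (fun y _ => hterm y) hyS
        rw [div_le_iff₀ (hRf y)] at h4
        have h5 : ε⁻¹ * meanDrift q V y ≤ ε⁻¹ * |meanDrift q V y| := by
          gcongr
          exact le_abs_self _
        linarith
      · have h4 : ε⁻¹ * meanDrift q V y ≤ ε⁻¹ * (-ε) := by
          gcongr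
          exact hdrift y hyS
        rw [mul_neg, inv_mul_cancel₀ hε.ne'] at h4
        nlinarith [hRf y]
    linarith
  refine lintegral_returnTime_lt_top he (W := fun y => ENNReal.ofReal (W y))
    (f := fun y => ENNReal.ofReal (f y)) (fun y hy => ?_) ?_ (fun y => by simpa using hf0 y)
    fun M => ?_
  · have hRy : 0 < R y := hR y
    have hs : 0 ≤ ∑ z ∈ N y, q y z * W z := Finset.sum_nonneg fun z _ => mul_nonneg (hq y z) (hW0 z)
    rw [lintegral_jumpLaw_ofReal hq hNx hN hR hW0, exitRate_eq_sum hq hNx hN,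
      ← ENNReal.ofReal_inv_of_pos hRy, ← ENNReal.ofReal_add (hf0 y).le (by positivity),
      ← ENNReal.ofReal_add (by positivity) (add_nonneg (hf0 y).le (by positivity))]
    refine ENNReal.ofReal_le_ofReal ?_
    have : (R y)⁻¹ * (1 + R y * f y + ∑ z ∈ N y, q y z * W z) ≤ W y := by
      rw [inv_mul_le_iff₀ hRy]
      exact hWsum y hy
    calc _ = (R y)⁻¹ * (1 + R y * f y + ∑ z ∈ N y, q y z * W z) := by
          change (R y)⁻¹ + (f y + (R y)⁻¹ * _) = _
          field_simp
          ring
      _ ≤ _ := this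
  · rw [lintegral_jumpLaw_ofReal hq hNx hN hR hW0]
    exact ENNReal.ofReal_ne_top
  · refine (hV.tendsto (ε * M - B)).subset fun y hy => ?_
    have h1 : W y ≤ M := by
      have := ENNReal.ofReal_le_iff_le_toReal ENNReal.coe_ne_top |>.1 hy
      simpa using this
    have h2 : 0 ≤ C * (1 - f y) := mul_nonneg (by linarith) (by linarith [hf1 y])
    have h3 : ε⁻¹ * (V y + B) ≤ M := by linarith
    rw [inv_mul_le_iff₀ hε] at h3
    simp only [Set.mem_ofPred_eq]
    linarith

end LocallyFinite

/-! ### Drift of `x₁ + v(x₂)` in the tandem system. -/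

section TandemLemmas

variable {lam : ℕ → ℝ} {μ₁ μ₂ : ℝ}

/-- A finite set that contains every state reachable from `x` in one jump. -/
def tandemNeighbors (x : ℕ × ℕ) : Finset (ℕ × ℕ) :=
  ({(x.1 + 1, x.2), (x.1 - 1, x.2 + 1), (x.1, x.2 - 1)} : Finset (ℕ × ℕ)).erase x

lemma notMem_tandemNeighbors (x : ℕ × ℕ) : x ∉ tandemNeighbors x := Finset.notMem_erase _ _

lemma tandemRate_eq_zero (x y : ℕ × ℕ) (hyx : y ≠ x) (hy : y ∉ tandemNeighbors x) :
    tandemRate lam μ₁ μ₂ x y = 0 := by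
  obtain ⟨a, b⟩ := x
  obtain ⟨c, d⟩ := y
  simp only [tandemNeighbors, Finset.mem_erase, ne_eq, hyx, not_false_eq_true, true_and,
    Finset.mem_insert, Finset.mem_singleton, Prod.mk.injEq] at hy
  unfold tandemRate
  rw [if_neg (by omega), if_neg (by omega), if_neg (by omega)]

/-- The three candidates stay distinct under truncated subtraction. When `x.2 = 0` the last one is
`x` itself, which is erased; `g x = 0` makes the formula uniform. -/
lemma sum_tandemNeighbors (g : ℕ × ℕ → ℝ) (x : ℕ × ℕ) (hg : g x = 0) :
    ∑ y ∈ tandemNeighbors x, g y = g (x.1 + 1, x.2) + g (x.1 - 1, x.2 + 1) + g (x.1, x.2 - 1) := by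
  obtain ⟨a, b⟩ := x
  rw [tandemNeighbors, Finset.sum_erase _ hg, Finset.sum_insert, Finset.sum_insert,
    Finset.sum_singleton, add_assoc]
  all_goals
    simp only [Finset.mem_insert, Finset.mem_singleton, Prod.mk.injEq]
    omega

lemma tandemRate_nonneg (hlam : ∀ n, 0 ≤ lam n) (hμ₁ : 0 < μ₁) (hμ₂ : 0 < μ₂) (x y : ℕ × ℕ) :
    0 ≤ tandemRate lam μ₁ μ₂ x y := by
  unfold tandemRate
  split_ifs
  exacts [hlam _, hμ₁.le, hμ₂.le, le_rfl]

lemma tandemRate_arrival (a b : ℕ) : tandemRate lam μ₁ μ₂ (a, b) (a + 1, b) = lam b := by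
  simp [tandemRate]

lemma tandemRate_transfer (a b : ℕ) : tandemRate lam μ₁ μ₂ (a + 1, b) (a, b + 1) = μ₁ := by
  simp [tandemRate]

lemma tandemRate_departure (a b : ℕ) : tandemRate lam μ₁ μ₂ (a, b + 1) (a, b) = μ₂ := by
  simp [tandemRate]

/-- No case distinction is needed at `b = 0`: there `b - 1 = b`, so the departure term vanishes. -/
lemma meanDrift_tandem_of_pos (v : ℕ → ℝ) (a b : ℕ) :
    meanDrift (tandemRate lam μ₁ μ₂) (fun y => (y.1 : ℝ) + v y.2) (a + 1, b)
      = lam b + (v (b + 1) - v b - 1) * μ₁ - (v b - v (b - 1)) * μ₂ := by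
  rw [meanDrift_eq_sum tandemRate_eq_zero, sum_tandemNeighbors _ _ (by simp)]
  simp only [Nat.add_sub_cancel, tandemRate_arrival, tandemRate_transfer]
  cases b with
  | zero => push_cast; ring_nf
  | succ b => rw [Nat.add_sub_cancel, tandemRate_departure]; push_cast; ring

lemma meanDrift_tandem_of_zero (v : ℕ → ℝ) (b : ℕ) :
    meanDrift (tandemRate lam μ₁ μ₂) (fun y => (y.1 : ℝ) + v y.2) (0, b + 1)
      = lam (b + 1) - (v (b + 1) - v b) * μ₂ := by
  rw [meanDrift_eq_sum tandemRate_eq_zero, sum_tandemNeighbors _ _ (by simp)]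
  have h : tandemRate lam μ₁ μ₂ (0, b + 1) (0 - 1, b + 1 + 1) = 0 := by
    unfold tandemRate
    rw [if_neg (by omega), if_neg (by omega), if_neg (by omega)]
  simp only [tandemRate_arrival, h, Nat.add_sub_cancel, tandemRate_departure]
  push_cast
  ring

lemma tandemV_succ_sub (r : ℝ) (n : ℕ) :
    tandemV lam μ₁ μ₂ r (n + 1) - tandemV lam μ₁ μ₂ r n
      = ∑ k ∈ Finset.range (n + 1), (1 - (lam k + r) / μ₁) * (μ₁ / μ₂) ^ ((k : ℤ) - (n : ℤ)) := by
  rw [tandemV, tandemV, Finset.sum_range_succ, add_sub_cancel_left]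

lemma zpow_sub_succ (hμ₁ : 0 < μ₁) (hμ₂ : 0 < μ₂) (k n : ℕ) :
    (μ₁ / μ₂) ^ ((k : ℤ) - ((n + 1 : ℕ) : ℤ)) = μ₂ / μ₁ * (μ₁ / μ₂) ^ ((k : ℤ) - (n : ℤ)) := by
  have h : μ₁ / μ₂ ≠ 0 := (div_pos hμ₁ hμ₂).ne'
  rw [show (k : ℤ) - ((n + 1 : ℕ) : ℤ) = (k : ℤ) - n - 1 by push_cast; ring, zpow_sub_one₀ h,
    inv_div, mul_comm]

lemma tandemV_recurrence (hμ₁ : 0 < μ₁) (hμ₂ : 0 < μ₂) (r : ℝ) (n : ℕ) :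
    lam n + (tandemV lam μ₁ μ₂ r (n + 1) - tandemV lam μ₁ μ₂ r n - 1) * μ₁
      - (tandemV lam μ₁ μ₂ r n - tandemV lam μ₁ μ₂ r (n - 1)) * μ₂ = -r := by
  rw [tandemV_succ_sub]
  cases n with
  | zero => simp; field_simp; ring
  | succ n =>
    rw [Nat.add_sub_cancel, tandemV_succ_sub, Finset.sum_range_succ]
    have : ∑ k ∈ Finset.range (n + 1), (1 - (lam k + r) / μ₁) *
        (μ₁ / μ₂) ^ ((k : ℤ) - ((n + 1 : ℕ) : ℤ)) = μ₂ / μ₁ *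
        ∑ k ∈ Finset.range (n + 1), (1 - (lam k + r) / μ₁) * (μ₁ / μ₂) ^ ((k : ℤ) - (n : ℤ)) := by
      rw [Finset.mul_sum]
      refine Finset.sum_congr rfl fun k _ => ?_
      rw [zpow_sub_succ hμ₁ hμ₂]
      ring
    rw [this, sub_self, zpow_zero]
    field_simp
    ring

lemma tandemV_zero (r : ℝ) : tandemV lam μ₁ μ₂ r 0 = 0 := by simp [tandemV]

/-- `V_r` is the only function `x₁ + v(x₂)` with `v(0) = 0` and drift `-r` where `x₁ > 0`. -/
lemma meanDrift_eq_neg_iff (hμ₁ : 0 < μ₁) (hμ₂ : 0 < μ₂) (r : ℝ) {v : ℕ → ℝ} (hv : v 0 = 0) :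
    (∀ x : ℕ × ℕ, 0 < x.1 →
        meanDrift (tandemRate lam μ₁ μ₂) (fun y => (y.1 : ℝ) + v y.2) x = -r) ↔
      (fun y : ℕ × ℕ => (y.1 : ℝ) + v y.2) = tandemLyapunov lam μ₁ μ₂ r := by
  constructor
  · intro h
    have hrec : ∀ n, lam n + (v (n + 1) - v n - 1) * μ₁ - (v n - v (n - 1)) * μ₂ = -r := fun n => by
      rw [← meanDrift_tandem_of_pos v 0 n]
      exact h _ Nat.one_pos
    -- The recurrence for `v` reaches back two values, so two consecutive ones are carried along.
    have hind : ∀ n, v (n - 1) = tandemV lam μ₁ μ₂ r (n - 1) ∧ v n = tandemV lam μ₁ μ₂ r n := by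
      intro n
      induction n with
      | zero => simp [hv, tandemV_zero]
      | succ n ih =>
        refine ⟨ih.2, ?_⟩
        have h1 := hrec n
        rw [← tandemV_recurrence (lam := lam) hμ₁ hμ₂ r n, ih.1, ih.2] at h1
        have h2 : (v (n + 1) - tandemV lam μ₁ μ₂ r (n + 1)) * μ₁ = 0 := by linarith
        rcases mul_eq_zero.1 h2 with h3 | h3
        · linarith
        · exact absurd h3 hμ₁.ne'
    funext y
    rw [tandemLyapunov, (hind y.2).2]
  · intro h
    have hv' : v = tandemV lam μ₁ μ₂ r := by
      funext n
      simpa [tandemLyapunov] using congrFun h (0, n)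
    rintro ⟨_ | a, b⟩ hx
    · exact absurd hx (lt_irrefl _)
    · rw [meanDrift_tandem_of_pos, hv', tandemV_recurrence hμ₁ hμ₂]

lemma meanDrift_tandemLyapunov_of_pos (hμ₁ : 0 < μ₁) (hμ₂ : 0 < μ₂) (r : ℝ) (a b : ℕ) :
    meanDrift (tandemRate lam μ₁ μ₂) (tandemLyapunov lam μ₁ μ₂ r) (a + 1, b) = -r :=
  (meanDrift_tandem_of_pos _ a b).trans (tandemV_recurrence hμ₁ hμ₂ r b)

/-- The recurrence at `b + 1` eliminates both `lam (b + 1)` and the increment below, leaving only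
the next increment. -/
lemma meanDrift_tandemLyapunov_of_zero (hμ₁ : 0 < μ₁) (hμ₂ : 0 < μ₂) (r : ℝ) (b : ℕ) :
    meanDrift (tandemRate lam μ₁ μ₂) (tandemLyapunov lam μ₁ μ₂ r) (0, b + 1)
      = μ₁ - r - μ₁ * (tandemV lam μ₁ μ₂ r (b + 1 + 1) - tandemV lam μ₁ μ₂ r (b + 1)) := by
  have h := tandemV_recurrence (lam := lam) hμ₁ hμ₂ r (b + 1)
  rw [Nat.add_sub_cancel] at h
  refine (meanDrift_tandem_of_zero _ b).trans ?_
  linarith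

/-! ### Increments of `v_r` and truncated geometric means. -/

lemma integral_truncGeom (lam : ℕ → ℝ) {z : ℝ} (hz : 0 < z) (n : ℕ) :
    ∫ j, lam j ∂(truncGeom n z)
      = (∑ j ∈ Finset.range (n + 1), z ^ j * lam j) / ∑ j ∈ Finset.range (n + 1), z ^ j := by
  rw [truncGeom, integral_finsetSum_measure, Finset.sum_div]
  · refine Finset.sum_congr rfl fun j _ => ?_
    rw [integral_smul_measure, integral_dirac, ENNReal.toReal_ofReal (by positivity), smul_eq_mul]
    ring
  · intro j _
    exact (integrable_dirac (by simp)).smul_measure ENNReal.ofReal_ne_top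

/-- The weights `(μ₁/μ₂)^(k-n)` in the increment are, once normalized, the law of `Zₙ`; reversing
the order of summation shows their total mass to be the sum in `μ₂/μ₁`. -/
lemma tandemV_increment (hμ₁ : 0 < μ₁) (hμ₂ : 0 < μ₂) (r : ℝ) (n : ℕ) :
    μ₁ * (tandemV lam μ₁ μ₂ r (n + 1) - tandemV lam μ₁ μ₂ r n)
      = (∑ k ∈ Finset.range (n + 1), (μ₂ / μ₁) ^ k) *
        (μ₁ - ∫ j, lam j ∂(truncGeom n (μ₁ / μ₂)) - r) := by
  have hz : 0 < μ₁ / μ₂ := div_pos hμ₁ hμ₂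
  have hS : 0 < ∑ j ∈ Finset.range (n + 1), (μ₁ / μ₂) ^ j :=
    Finset.sum_pos (fun j _ => by positivity) (by simp)
  have ha : ∑ k ∈ Finset.range (n + 1), (μ₂ / μ₁) ^ k
      = (∑ j ∈ Finset.range (n + 1), (μ₁ / μ₂) ^ j) * (μ₁ / μ₂) ^ (-(n : ℤ)) := by
    rw [← Finset.sum_range_reflect, Finset.sum_mul]
    refine Finset.sum_congr rfl fun k hk => ?_
    have hk : k ≤ n := Nat.lt_succ_iff.1 (Finset.mem_range.1 hk)
    rw [show n + 1 - 1 - k = n - k by omega, ← inv_div μ₁ μ₂, inv_pow, zpow_neg, zpow_natCast,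
      ← div_eq_mul_inv, eq_div_iff (by positivity), ← Nat.sub_add_cancel hk, pow_add,
      Nat.add_sub_cancel]
    field_simp
  rw [tandemV_succ_sub, integral_truncGeom lam hz, ha]
  have hsum : ∑ k ∈ Finset.range (n + 1), (1 - (lam k + r) / μ₁) *
      (μ₁ / μ₂) ^ ((k : ℤ) - (n : ℤ)) = (μ₁ / μ₂) ^ (-(n : ℤ)) *
        ((1 - r / μ₁) * (∑ j ∈ Finset.range (n + 1), (μ₁ / μ₂) ^ j) -
          (∑ j ∈ Finset.range (n + 1), (μ₁ / μ₂) ^ j * lam j) / μ₁) := by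
    rw [Finset.mul_sum, Finset.sum_div, ← Finset.sum_sub_distrib, Finset.mul_sum]
    refine Finset.sum_congr rfl fun k _ => ?_
    rw [sub_eq_add_neg (k : ℤ), zpow_add₀ hz.ne', zpow_natCast]
    ring
  rw [hsum]
  field_simp
  ring

/-- The inverses of the partial geometric sums with ratio `μ₂ / μ₁` tend to
`1 - min μ₁ μ₂ / μ₁`. -/
lemma tendsto_inv_geom_sum (hμ₁ : 0 < μ₁) (hμ₂ : 0 < μ₂) :
    Tendsto (fun n => (∑ k ∈ Finset.range (n + 1), (μ₂ / μ₁) ^ k)⁻¹) atTop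
      (𝓝 (1 - min μ₁ μ₂ / μ₁)) := by
  refine (tendsto_add_atTop_iff_nat (f := fun n => (∑ k ∈ Finset.range n, (μ₂ / μ₁) ^ k)⁻¹) 1).2 ?_
  rcases lt_or_ge μ₂ μ₁ with h | h
  · rw [min_eq_right h.le]
    have h1 : μ₂ / μ₁ < 1 := (div_lt_one hμ₁).2 h
    have := (hasSum_geometric_of_lt_one (by positivity) h1).tendsto_sum_nat.inv₀
      (inv_ne_zero (by linarith))
    rwa [inv_inv] at this
  · rw [min_eq_left h, div_self hμ₁.ne', sub_self]
    refine Tendsto.inv_tendsto_atTop (tendsto_atTop_mono (fun n => ?_) tendsto_natCast_atTop_atTop)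
    have h1 : 1 ≤ μ₂ / μ₁ := (one_le_div hμ₁).2 h
    calc (n : ℝ) = ∑ k ∈ Finset.range n, 1 := by simp
      _ ≤ _ := Finset.sum_le_sum fun k _ => one_le_pow₀ h1

lemma sum_ratio_pow_pos (hμ₁ : 0 < μ₁) (hμ₂ : 0 < μ₂) (n : ℕ) :
    0 < ∑ k ∈ Finset.range (n + 1), (μ₂ / μ₁) ^ k :=
  Finset.sum_pos (fun j _ => by positivity) (by simp)

lemma limsupCondition_iff :
    LimsupCondition lam μ₁ μ₂ ↔
      ∃ c < min μ₁ μ₂, ∀ᶠ n in atTop, ∫ j, lam j ∂(truncGeom n (μ₁ / μ₂)) ≤ c := by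
  constructor
  · intro h
    obtain ⟨c, hc, hcm⟩ := EReal.lt_iff_exists_real_btwn.1 h
    refine ⟨c, by exact_mod_cast hcm, ?_⟩
    filter_upwards [eventually_lt_of_limsup_lt hc] with n hn
    exact_mod_cast hn.le
  · rintro ⟨c, hc, h⟩
    refine lt_of_le_of_lt (limsup_le_of_le (a := (c : EReal)) (by isBoundedDefault) ?_)
      (by exact_mod_cast hc)
    filter_upwards [h] with n hn
    exact_mod_cast hn

lemma exists_lt_of_eventually_increment (hμ₁ : 0 < μ₁) (hμ₂ : 0 < μ₂) {r ε : ℝ} (hr : 0 < r)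
    (hε : 0 < ε)
    (h : ∀ᶠ n in atTop, μ₁ - r + ε ≤
      μ₁ * (tandemV lam μ₁ μ₂ r (n + 1) - tandemV lam μ₁ μ₂ r n)) :
    LimsupCondition lam μ₁ μ₂ := by
  rw [limsupCondition_iff]
  set κ := 1 - min μ₁ μ₂ / μ₁ with hκ
  have hm : μ₁ * (1 - κ) = min μ₁ μ₂ := by rw [hκ]; field_simp; ring
  have hm0 : 0 < min μ₁ μ₂ := lt_min hμ₁ hμ₂
  have hκ0 : 0 ≤ κ := sub_nonneg.2 ((div_le_one hμ₁).2 (min_le_left _ _))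
  have hκ1 : 0 < 1 - κ := by rw [hκ, sub_sub_cancel]; positivity
  have hlim : Tendsto (fun n => μ₁ - r - (μ₁ - r + ε) *
      (∑ k ∈ Finset.range (n + 1), (μ₂ / μ₁) ^ k)⁻¹) atTop (𝓝 (μ₁ - r - (μ₁ - r + ε) * κ)) :=
    ((tendsto_inv_geom_sum hμ₁ hμ₂).const_mul _).const_sub _
  -- The difference of the two sides is `r (1 - κ) + ε κ`.
  have hlt : μ₁ - r - (μ₁ - r + ε) * κ < min μ₁ μ₂ := by
    rw [← hm]
    nlinarith [mul_pos hr hκ1, mul_nonneg hε.le hκ0]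
  obtain ⟨c, hc1, hc2⟩ := exists_between hlt
  refine ⟨c, hc2, ?_⟩
  filter_upwards [h, hlim.eventually_lt_const hc1] with n hn hnc
  rw [tandemV_increment hμ₁ hμ₂] at hn
  have ha := sum_ratio_pow_pos hμ₁ hμ₂ n
  have : (μ₁ - r + ε) * (∑ k ∈ Finset.range (n + 1), (μ₂ / μ₁) ^ k)⁻¹
      ≤ μ₁ - ∫ j, lam j ∂(truncGeom n (μ₁ / μ₂)) - r := by
    rw [mul_inv_le_iff₀ ha, mul_comm]
    exact hn
  linarith

/-- The bound `1` serves twice: it makes `v_r` tend to infinity and brings the boundary drift down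
to `-r`. -/
lemma LimsupCondition.exists_eventually_increment (hμ₁ : 0 < μ₁) (hμ₂ : 0 < μ₂)
    (h : LimsupCondition lam μ₁ μ₂) :
    ∃ r, 0 < r ∧ ∀ᶠ n in atTop, 1 ≤ tandemV lam μ₁ μ₂ r (n + 1) - tandemV lam μ₁ μ₂ r n := by
  obtain ⟨c, hc, hev⟩ := limsupCondition_iff.1 h
  set κ := 1 - min μ₁ μ₂ / μ₁ with hκ
  have hm : μ₁ * (1 - κ) = min μ₁ μ₂ := by rw [hκ]; field_simp; ring
  have hr : 0 < (min μ₁ μ₂ - c) / 2 := by linarith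
  set r := (min μ₁ μ₂ - c) / 2 with hrdef
  refine ⟨r, hr, ?_⟩
  -- Here `μ₁ κ = μ₁ - min μ₁ μ₂`, so any `r` smaller than the gap `min μ₁ μ₂ - c` would do; half
  -- the gap is taken.
  have hlt : μ₁ * κ < μ₁ - c - r := by linarith
  filter_upwards [hev, ((tendsto_inv_geom_sum hμ₁ hμ₂).const_mul μ₁).eventually_lt_const hlt]
    with n hn hnc
  have ha := sum_ratio_pow_pos hμ₁ hμ₂ n
  refine le_of_mul_le_mul_left ?_ hμ₁
  rw [tandemV_increment hμ₁ hμ₂, mul_one]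
  rw [mul_inv_lt_iff₀ ha] at hnc
  nlinarith

lemma tendsto_atTop_of_increment {v : ℕ → ℝ} (h : ∀ᶠ n in atTop, 1 ≤ v (n + 1) - v n) :
    Tendsto v atTop atTop := by
  obtain ⟨n₀, h⟩ := eventually_atTop.1 h
  rw [← tendsto_add_atTop_iff_nat n₀]
  refine tendsto_atTop_mono (f := fun n : ℕ => v n₀ + n) (fun n => ?_)
    (tendsto_atTop_add_const_left _ _ tendsto_natCast_atTop_atTop)
  induction n with
  | zero => simp
  | succ n ih =>
    have := h (n + n₀) (Nat.le_add_left _ _)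
    rw [show n + 1 + n₀ = n + n₀ + 1 by ring]
    push_cast
    linarith

lemma isLyapunovFunction_tandem (hμ₁ : 0 < μ₁) (hμ₂ : 0 < μ₂) {r : ℝ} (hr : 0 < r)
    (h : ∀ᶠ n in atTop, 1 ≤ tandemV lam μ₁ μ₂ r (n + 1) - tandemV lam μ₁ μ₂ r n) :
    IsLyapunovFunction (tandemRate lam μ₁ μ₂) (tandemLyapunov lam μ₁ μ₂ r) := by
  refine ⟨summable_meanDrift_abs tandemRate_eq_zero _, fun M => ?_, ?_⟩
  · have hv := tendsto_atTop_of_increment h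
    obtain ⟨b, hb⟩ := bddBelow_range_of_tendsto_atTop_atTop hv
    have hfin : {n | tandemV lam μ₁ μ₂ r n ≤ M}.Finite := by
      obtain ⟨n₀, hn₀⟩ := eventually_atTop.1 (hv.eventually_gt_atTop M)
      refine (Set.finite_lt_nat n₀).subset fun n hn => ?_
      by_contra hlt
      exact absurd (hn₀ n (not_lt.1 hlt)) (not_lt.2 hn)
    refine ((Set.finite_le_nat ⌈M - b⌉₊).prod hfin).subset fun x hx => ⟨?_, ?_⟩
    · have h1 : b ≤ tandemV lam μ₁ μ₂ r x.2 := hb ⟨x.2, rfl⟩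
      have h2 : (x.1 : ℝ) + tandemV lam μ₁ μ₂ r x.2 ≤ M := hx
      have h3 : (x.1 : ℝ) ≤ ⌈M - b⌉₊ := le_trans (by linarith) (Nat.le_ceil _)
      exact_mod_cast h3
    · have h2 : (x.1 : ℝ) + tandemV lam μ₁ μ₂ r x.2 ≤ M := hx
      have h3 : (0 : ℝ) ≤ x.1 := Nat.cast_nonneg _
      change tandemV lam μ₁ μ₂ r x.2 ≤ M
      linarith
  · obtain ⟨n₀, hn₀⟩ := eventually_atTop.1 h
    -- The exceptional set always contains the origin, which the boundary formula does not cover.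
    refine ⟨{0} ×ˢ Finset.range (n₀ + 1), lt_of_le_of_lt (b := ((-r : ℝ) : EReal)) ?_
      (by exact_mod_cast neg_neg_of_pos hr)⟩
    refine iSup₂_le fun x hx => ?_
    rw [EReal.coe_le_coe_iff]
    obtain ⟨_ | a, b⟩ := x
    · have hb : n₀ < b := by
        by_contra hb
        exact hx (by simpa [Nat.lt_succ_iff] using hb)
      obtain ⟨b, rfl⟩ := Nat.exists_eq_succ_of_ne_zero (Nat.ne_zero_of_lt hb)
      rw [Nat.succ_eq_add_one, meanDrift_tandemLyapunov_of_zero hμ₁ hμ₂]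
      have := mul_le_mul_of_nonneg_left (hn₀ (b + 1) hb.le) hμ₁.le
      linarith
    · exact (meanDrift_tandemLyapunov_of_pos hμ₁ hμ₂ r a b).le

lemma IsLyapunovFunction.limsupCondition (hμ₁ : 0 < μ₁) (hμ₂ : 0 < μ₂) {r : ℝ} (hr : 0 < r)
    (h : IsLyapunovFunction (tandemRate lam μ₁ μ₂) (tandemLyapunov lam μ₁ μ₂ r)) :
    LimsupCondition lam μ₁ μ₂ := by
  obtain ⟨S₀, ε, hε, hS₀⟩ := h.exists_drift_le
  refine exists_lt_of_eventually_increment hμ₁ hμ₂ hr hε ?_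
  filter_upwards [eventually_gt_atTop ((S₀.image Prod.snd).sup id)] with n hn
  have hmem : ((0, n) : ℕ × ℕ) ∉ S₀ := fun hmem =>
    absurd (Finset.le_sup (f := id) (Finset.mem_image_of_mem Prod.snd hmem)) (not_le.2 hn)
  have hd := hS₀ _ hmem
  obtain ⟨n, rfl⟩ := Nat.exists_eq_succ_of_ne_zero (Nat.ne_zero_of_lt hn)
  rw [Nat.succ_eq_add_one, meanDrift_tandemLyapunov_of_zero hμ₁ hμ₂] at hd
  linarith

/-! ### Non-absorption and irreducibility of the tandem system. -/

lemma sum_tandemRate_pos (hlam : ∀ n, 0 ≤ lam n) (hμ₁ : 0 < μ₁) (hμ₂ : 0 < μ₂)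
    (h0 : 0 < lam 0) (x : ℕ × ℕ) : 0 < ∑ y ∈ tandemNeighbors x, tandemRate lam μ₁ μ₂ x y := by
  have key : ∀ y, 0 < tandemRate lam μ₁ μ₂ x y → y ≠ x →
      0 < ∑ y ∈ tandemNeighbors x, tandemRate lam μ₁ μ₂ x y := fun y hy hyx => by
    refine Finset.sum_pos' (fun y _ => tandemRate_nonneg hlam hμ₁ hμ₂ x y) ⟨y, ?_, hy⟩
    by_contra hmem
    exact hy.ne' (tandemRate_eq_zero x y hyx hmem)
  obtain ⟨_ | a, _ | b⟩ := x
  · exact key (0 + 1, 0) (by rwa [tandemRate_arrival]) (by simp)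
  · exact key (0, b) (by rwa [tandemRate_departure]) (by simp)
  all_goals exact key (a, _ + 1) (by rwa [tandemRate_transfer]) (by simp)

/-- Every state drains to the origin. From there `(a, b)` is reached by `a + b` arrivals while node
2 is empty, followed by `b` transfers; thus only `lam 0` has to be positive. -/
lemma reflTransGen_tandemRate (hμ₁ : 0 < μ₁) (hμ₂ : 0 < μ₂) (h0 : 0 < lam 0) (x y : ℕ × ℕ) :
    Relation.ReflTransGen (fun a b => a ≠ b ∧ 0 < tandemRate lam μ₁ μ₂ a b) x y := by
  set T := fun a b : ℕ × ℕ => a ≠ b ∧ 0 < tandemRate lam μ₁ μ₂ a b with hT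
  have s1 : ∀ a, T (a, 0) (a + 1, 0) := fun a => ⟨by simp, by rwa [tandemRate_arrival]⟩
  have s2 : ∀ a b, T (a + 1, b) (a, b + 1) := fun a b =>
    ⟨by simp, by rwa [tandemRate_transfer]⟩
  have s3 : ∀ a b, T (a, b + 1) (a, b) := fun a b => ⟨by simp, by rwa [tandemRate_departure]⟩
  have d1 : ∀ a b, Relation.ReflTransGen T (a, b) (a, 0) := fun a b => by
    induction b with
    | zero => exact .refl
    | succ b ih => exact .head (s3 a b) ih
  have d2 : ∀ a, Relation.ReflTransGen T (a, 0) (0, 0) := fun a => by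
    induction a with
    | zero => exact .refl
    | succ a ih => exact .head (s2 a 0) (.head (s3 a 0) ih)
  have u1 : ∀ a, Relation.ReflTransGen T (0, 0) (a, 0) := fun a => by
    induction a with
    | zero => exact .refl
    | succ a ih => exact .tail ih (s1 a)
  have u2 : ∀ b a, Relation.ReflTransGen T (0, 0) (a, b) := fun b => by
    induction b with
    | zero => exact u1
    | succ b ih => exact fun a => .tail (ih (a + 1)) (s2 a b)
  exact ((d1 x.1 x.2).trans (d2 x.1)).trans (u2 y.2 y.1)

end TandemLemmas

end

theorem mainTheorem1 (lam : ℕ → ℝ) (hlam : ∀ n, 0 ≤ lam n)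
    (μ₁ μ₂ : ℝ) (hμ₁ : 0 < μ₁) (hμ₂ : 0 < μ₂) :
    (∀ r : ℝ, 0 < r → ∀ v : ℕ → ℝ, v 0 = 0 →
      ((∀ x : ℕ × ℕ, 0 < x.1 →
          meanDrift (tandemRate lam μ₁ μ₂) (fun y => (y.1 : ℝ) + v y.2) x = -r) ↔
        (fun y : ℕ × ℕ => (y.1 : ℝ) + v y.2) = tandemLyapunov lam μ₁ μ₂ r)) ∧
    ((∃ V ∈ tandemFamily lam μ₁ μ₂, IsLyapunovFunction (tandemRate lam μ₁ μ₂) V) ↔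
      LimsupCondition lam μ₁ μ₂) ∧
    (0 < lam 0 → LimsupCondition lam μ₁ μ₂ → IsStableTandem lam μ₁ μ₂) := by
  refine ⟨fun r _ v hv => meanDrift_eq_neg_iff hμ₁ hμ₂ r hv, ⟨?_, fun h => ?_⟩, fun h0 h => ?_⟩
  · rintro ⟨V, ⟨r, hr, rfl⟩, hV⟩
    exact hV.limsupCondition hμ₁ hμ₂ hr
  · obtain ⟨r, hr, hinc⟩ := h.exists_eventually_increment hμ₁ hμ₂
    exact ⟨_, ⟨r, hr, rfl⟩, isLyapunovFunction_tandem hμ₁ hμ₂ hr hinc⟩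
  · obtain ⟨r, hr, hinc⟩ := h.exists_eventually_increment hμ₁ hμ₂
    exact (isLyapunovFunction_tandem hμ₁ hμ₂ hr hinc).ergodic
      (tandemRate_nonneg hlam hμ₁ hμ₂) notMem_tandemNeighbors tandemRate_eq_zero
      (sum_tandemRate_pos hlam hμ₁ hμ₂ h0) (reflTransGen_tandemRate hμ₁ hμ₂ h0)
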